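/- Let $d\ge 1$. For $n\in\mathbb Z$ the dyadic cubes of generation $n$ in $\mathbb R^d$ are the half-open cubes $\prod_{i=1}^d[k_i2^{-n},(k_i+1)2^{-n})$, $k\in\mathbb Z^d$, and $\mathcal F_n$ is the $\sigma$-field that they generate. A (real-valued) dyadic martingale is a sequence $f=(f_n)_{n\in\mathbb Z}$ of locally integrable functions on $\mathbb R^d$ such that $f_n$ is $\mathcal F_n$-measurable and $\int_Q f_n\,dx=\int_Q f_m\,dx$ for all $m\le n$ and all dyadic cubes $Q$ of generation $m$. For such $f$ and $r>2$ put \[ \mathcal M(f)=\sup_{n\in\mathbb Z}|f_n|,\qquad S(f)=\Big(\sum_{n\in\mathbb Z}|f_n-f_{n-1}|^2\Big)^{1/2},\qquad V_r(f)=\sup_{n_0<n_1<\dots<n_J}\Big(\sum_{j=1}^J|f_{n_j}-f_{n_{j-1}}|^r\Big)^{1/r}, \] with values in $[0,\infty]$. A non-negative locally integrable function $w$ on $\mathbb R^d$ is a dyadic $A_\infty$ weight if for every $\epsilon>0$ there is $\gamma>0$ such that for every dyadic cube $I$ and every measurable $E\subseteq I$ with $|E|\le\gamma|I|$ one has $w(E)\le\epsilon\,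 w(I)$, where $w(E)=\int_E w\,dx$. Let $w$ be a dyadic $A_\infty$ weight on $\mathbb R^d$. Then: (i) There is $C>0$ such that for each $\epsilon>0$ and $r>2$ there is $\delta>0$ such that for every dyadic martingale $f$ and all $\lambda>0$ \[ w\{V_r(f)>3\lambda,\ \mathcal M(f)<\delta\lambda\}\le C\, w\{S(f)>\delta\lambda\}+\epsilon\, w\{V_r(f)>\lambda\}. \] (ii) For each $p\in[1,\infty)$ and $r>2$ there is $C_{p,r}>0$ such that for every dyadic martingale $f$ \[ C_{p,r}\,\|V_r(f)\|_{L^p(w)}\le \|S(f)\|_{L^p(w)}+\|\mathcal M(f)\|_{L^p(w)}. \] -/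

import Mathlib

open MeasureTheory
open scoped ENNReal

/-- The half-open dyadic cube of generation `n : ℤ` (side length `2 ^ (-n)`) in `ℝ^d` with lower
corner `2 ^ (-n) • k`. -/
def dyadicCube {d : ℕ} (n : ℤ) (k : Fin d → ℤ) : Set (Fin d → ℝ) :=
  {x | ∀ i, (k i : ℝ) * 2 ^ (-n) ≤ x i ∧ x i < ((k i : ℝ) + 1) * 2 ^ (-n)}

lemma measurableSet_dyadicCube {d : ℕ} (n : ℤ) (k : Fin d → ℤ) :
    MeasurableSet (dyadicCube n k) := by
  have : dyadicCube n k = ⋂ i, ({x : Fin d → ℝ | (k i : ℝ) * 2 ^ (-n) ≤ x i} ∩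
      {x | x i < ((k i : ℝ) + 1) * 2 ^ (-n)}) := by
    ext x; simp [dyadicCube]
  rw [this]
  exact MeasurableSet.iInter fun i =>
    (measurableSet_le measurable_const (measurable_pi_apply i)).inter
      (measurableSet_lt (measurable_pi_apply i) measurable_const)

/-- A cube of generation `n` is the union of the cubes of a finer generation `m` inside it. -/
lemma dyadicCube_eq_iUnion {d : ℕ} {n m : ℤ} (h : n ≤ m) (k : Fin d → ℤ) :
    dyadicCube n k = ⋃ (j : Fin d → ℤ) (_ : dyadicCube m j ⊆ dyadicCube n k), dyadicCube m j := by
  refine Set.Subset.antisymm (fun x hx => ?_) (Set.iUnion₂_subset fun j hj => hj)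
  obtain ⟨t, rfl⟩ := Int.le.dest h
  have hm : (0 : ℝ) < 2 ^ (-(n + (t : ℤ))) := by positivity
  have hs : (2 : ℝ) ^ (-n) = 2 ^ t * 2 ^ (-(n + (t : ℤ))) := by
    rw [← zpow_natCast, ← zpow_add₀ (by norm_num)]
    congr 1
    ring
  simp only [dyadicCube, Set.mem_ofPred_eq] at hx
  rw [hs] at hx
  simp only [Set.mem_iUnion]
  refine ⟨fun i => ⌊x i / 2 ^ (-(n + (t : ℤ)))⌋, ?_, ?_⟩
  · intro y hy i
    obtain ⟨h1, h2⟩ := hy i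
    obtain ⟨h3, h4⟩ := hx i
    rw [hs]
    have h5 : (k i * 2 ^ t : ℤ) ≤ ⌊x i / 2 ^ (-(n + (t : ℤ)))⌋ := by
      rw [Int.le_floor, le_div_iff₀ hm]
      push_cast
      linarith
    have h6 : ⌊x i / 2 ^ (-(n + (t : ℤ)))⌋ + 1 ≤ ((k i + 1) * 2 ^ t : ℤ) := by
      rw [Int.add_one_le_iff, Int.floor_lt, div_lt_iff₀ hm]
      push_cast
      linarith
    have h5' : ((k i : ℝ) * 2 ^ t) ≤ (⌊x i / 2 ^ (-(n + (t : ℤ)))⌋ : ℝ) := by exact_mod_cast h5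
    have h6' : (⌊x i / 2 ^ (-(n + (t : ℤ)))⌋ : ℝ) + 1 ≤ ((k i : ℝ) + 1) * 2 ^ t := by
      exact_mod_cast h6
    constructor
    · calc (k i : ℝ) * (2 ^ t * 2 ^ (-(n + (t : ℤ)))) = (k i * 2 ^ t) * 2 ^ (-(n + (t : ℤ))) := by
            ring
        _ ≤ _ := mul_le_mul_of_nonneg_right h5' hm.le
        _ ≤ y i := h1
    · calc y i < _ := h2
        _ ≤ _ := mul_le_mul_of_nonneg_right h6' hm.le
        _ = ((k i : ℝ) + 1) * (2 ^ t * 2 ^ (-(n + (t : ℤ)))) := by ring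
  · intro i
    constructor
    · rw [← le_div_iff₀ hm]
      exact Int.floor_le _
    · rw [← div_lt_iff₀ hm]
      exact Int.lt_floor_add_one _

/-- The dyadic filtration on `ℝ^d`: the `n`-th σ-field is generated by the dyadic cubes of
generation `n`. -/
def dyadicFiltration (d : ℕ) :
    Filtration ℤ (inferInstance : MeasurableSpace (Fin d → ℝ)) where
  seq n := MeasurableSpace.generateFrom (Set.range fun k : Fin d → ℤ => dyadicCube n k)
  mono' n m h := by
    refine MeasurableSpace.generateFrom_le ?_
    rintro _ ⟨k, rfl⟩
    change MeasurableSet[MeasurableSpace.generateFrom _] (dyadicCube n k)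
    rw [dyadicCube_eq_iUnion h k]
    exact MeasurableSet.iUnion fun j => MeasurableSet.iUnion fun _ =>
      MeasurableSpace.measurableSet_generateFrom ⟨j, rfl⟩
  le' n := by
    refine MeasurableSpace.generateFrom_le ?_
    rintro _ ⟨k, rfl⟩
    exact measurableSet_dyadicCube n k

/-- Martingales for the dyadic filtration on `ℝ^d` with Lebesgue measure, in the sense of
σ-finite measure spaces: `f n` is adapted and locally integrable (not necessarily integrable on
all of `ℝ^d`, so that the averages of any locally integrable function are included), and the
conditional expectation of `f n` on the `m`-th σ-field, `m ≤ n`, is `f m`, which is tested on the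
atoms of that σ-field. -/
structure IsDyadicMartingale {d : ℕ} (f : ℤ → (Fin d → ℝ) → ℝ) : Prop where
  adapted : ∀ n, Measurable[dyadicFiltration d n] (f n)
  locallyIntegrable : ∀ n, LocallyIntegrable (f n) volume
  setIntegral_eq : ∀ m n, m ≤ n → ∀ k : Fin d → ℤ,
    ∫ x in dyadicCube m k, f n x = ∫ x in dyadicCube m k, f m x

/-- The maximal function `sup_n |f_n|`. -/
noncomputable def maximalFunction {X : Type*} (f : ℤ → X → ℝ) (x : X) : ℝ≥0∞ :=
  ⨆ n : ℤ, ‖f n x‖ₑ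

/-- The square function `(∑_n |f_n - f_{n-1}|^2)^{1/2}`. -/
noncomputable def squareFunction {X : Type*} (f : ℤ → X → ℝ) (x : X) : ℝ≥0∞ :=
  (∑' n : ℤ, ‖f n x - f (n - 1) x‖ₑ ^ 2) ^ (1 / 2 : ℝ)

/-- The `r`-variation: the supremum over `n_0 < n_1 < ... < n_J` of
`(∑_{j=1}^J |f_{n_j} - f_{n_{j-1}}|^r)^{1/r}`. -/
noncomputable def rVariation {X : Type*} (r : ℝ) (f : ℤ → X → ℝ) (x : X) : ℝ≥0∞ :=
  ⨆ (J : ℕ) (n : Fin (J + 1) → ℤ) (_ : StrictMono n),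
    (∑ j : Fin J, ‖f (n j.succ) x - f (n j.castSucc) x‖ₑ ^ r) ^ (1 / r)

/-- The measure `w(E) = ∫_E w dx`. -/
noncomputable def weightMeasure {d : ℕ} (w : (Fin d → ℝ) → ℝ) : Measure (Fin d → ℝ) :=
  volume.withDensity fun x => ENNReal.ofReal (w x)

/-- Dyadic `A_∞` weights on `ℝ^d`. -/
structure IsDyadicAInfty {d : ℕ} (w : (Fin d → ℝ) → ℝ) : Prop where
  nonneg : ∀ x, 0 ≤ w x
  locallyIntegrable : LocallyIntegrable w volume
  small_of_small : ∀ ε : ℝ, 0 < ε → ∃ γ : ℝ, 0 < γ ∧ ∀ (n : ℤ) (k : Fin d → ℤ)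
    (E : Set (Fin d → ℝ)), MeasurableSet E → E ⊆ dyadicCube n k →
      volume E ≤ ENNReal.ofReal γ * volume (dyadicCube n k) →
      weightMeasure w E ≤ ENNReal.ofReal ε * weightMeasure w (dyadicCube n k)

/-! For (i), start the times at a generation `N` and stop at the first generation `n` where the
variation so far exceeds `λ`. On a stopping cube `I` let `G` be the set where the variation exceeds
`3λ` although the maximal and square functions are at most `B = δλ`. Splitting variation sums at
`n`, the part before `n` gives at most `λ^r` and the one increment across `n` at most `(2B)^r ≤
λ^r`; since `3^r ≥ 3`, the jump-count bound for the part after `n` must be at least `λ^r` on `G`.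
Its integral is at most `C B^r |I|`, so Markov's inequality gives `|G| ≤ C δ^r |I|`
(`volume_clampVariation_le`). The `A_∞` condition turns this into `w(G) ≤ ε w(I)`, and the stopping
cubes are disjoint and lie in the set where the variation exceeds `λ` (`good_lambda_cube`).

For that integral, a variation sum of a sequence bounded by `B` is at most the sum over `k` of `(2B
2^{-k})^r` times the number of greedy jumps of size `B 2^{-k-1}` (`sum_rpow_le_tsum_greedyState`).
The number of jumps of size `μ` has integral at most a constant times `(B/μ)^2 |I|`
(`setLIntegral_greedyState_le`), and `r > 2` makes the series converge. To count jumps, the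
potential `μ² · count + (distance to anchor)²` grows by at most a squared increment plus a
martingale difference. The martingale may be huge on a child cube that misses `G`, so integrals run
only over cubes meeting `G`; a lost child has `2^{-d}` of its parent's volume, and its reserve pays
for the bounded increase on its siblings (`setLIntegral_compensatedPotential_succ_le_cube`).

Part (ii) follows from the local good-`λ` inequality by a truncated layer-cake argument on each
cube, where `w` is finite (`lintegral_rpow_le_of_good_lambda`), then by summing over cubes and
letting `N → -∞`. -/

/-! ### Variation sums of a single sequence -/

/-- A monotone sequence of times may be replaced by a strictly monotone one with the same
variation sum and the same last time. -/
lemma exists_strictMono_sum_eq (r : ℝ) (hr : 0 < r) (u : ℤ → ℝ) :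
    ∀ (J : ℕ) (n : Fin (J + 1) → ℤ), Monotone n →
      ∃ (J' : ℕ) (n' : Fin (J' + 1) → ℤ), StrictMono n' ∧ n' (Fin.last J') = n (Fin.last J) ∧
        ∑ j : Fin J, ‖u (n j.succ) - u (n j.castSucc)‖ₑ ^ r =
          ∑ j : Fin J', ‖u (n' j.succ) - u (n' j.castSucc)‖ₑ ^ r := by
  intro J
  induction J with
  | zero =>
    intro n _
    exact ⟨0, n, Subsingleton.strictMono (α := Fin 1) n, rfl, rfl⟩
  | succ J ih =>
    intro n hn
    obtain ⟨J', n', hs, hl, he⟩ := ih (fun i => n i.castSucc)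
      (fun a b h => hn (Fin.castSucc_le_castSucc_iff.2 h))
    have hle : n (Fin.last J).castSucc ≤ n (Fin.last (J + 1)) := hn (Fin.le_last _)
    rw [Fin.sum_univ_castSucc]
    simp only [Fin.succ_castSucc, he, Fin.succ_last]
    rcases hle.eq_or_lt with h | h
    · refine ⟨J', n', hs, hl.trans h, ?_⟩
      simp [h, hr]
    · refine ⟨J' + 1, Fin.snoc (α := fun _ => ℤ) n' (n (Fin.last (J + 1))), ?_, ?_, ?_⟩
      · rw [Fin.strictMono_iff_lt_succ]
        intro i
        refine Fin.lastCases ?_ (fun i => ?_) i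
        · rw [Fin.succ_last, Fin.snoc_last, Fin.snoc_castSucc, hl]
          exact h
        · rw [Fin.succ_castSucc, Fin.snoc_castSucc, Fin.snoc_castSucc]
          exact hs Fin.castSucc_lt_succ
      · simp
      · rw [Fin.sum_univ_castSucc]
        simp only [Fin.succ_castSucc, Fin.snoc_castSucc, Fin.succ_last, Fin.snoc_last, hl]

/-- Times merged by `φ` contribute `0 ^ r = 0` and can be dropped. Truncations in time are such
substitutions, so every comparison between truncated variations comes from here. -/
lemma rVariation_comp_le {X : Type*} {r : ℝ} (hr : 0 < r) (f : ℤ → X → ℝ) {φ : ℤ → ℤ}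
    (hφ : Monotone φ) (x : X) : rVariation r (fun m => f (φ m)) x ≤ rVariation r f x := by
  refine iSup_le fun J => iSup_le fun n => iSup_le fun hn => ?_
  obtain ⟨J', n', hs, -, he⟩ := exists_strictMono_sum_eq r hr (fun m => f m x) J (fun j => φ (n j))
    (hφ.comp hn.monotone)
  rw [he]
  exact le_iSup_of_le J' (le_iSup_of_le n' (le_iSup_of_le hs le_rfl))

lemma lt_rVariation_iff {X : Type*} {r : ℝ} (hr : 0 < r) (f : ℤ → X → ℝ) (x : X) (a : ℝ≥0∞) :
    a < rVariation r f x ↔ ∃ (J : ℕ) (n : Fin (J + 1) → ℤ), StrictMono n ∧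
      a ^ r < ∑ j : Fin J, ‖f (n j.succ) x - f (n j.castSucc) x‖ₑ ^ r := by
  simp only [rVariation, lt_iSup_iff]
  refine exists_congr fun J => exists_congr fun n => ?_
  rw [one_div, exists_prop, ENNReal.lt_rpow_inv_iff hr]

lemma sum_rpow_le_of_rVariation_le {X : Type*} {r : ℝ} (hr : 0 < r) {f : ℤ → X → ℝ} {x : X}
    {a : ℝ≥0∞} (h : rVariation r f x ≤ a) {J : ℕ} {n : Fin (J + 1) → ℤ} (hn : StrictMono n) :
    ∑ j : Fin J, ‖f (n j.succ) x - f (n j.castSucc) x‖ₑ ^ r ≤ a ^ r := by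
  by_contra hc
  exact h.not_gt ((lt_rVariation_iff hr f x a).2 ⟨J, n, hn, not_le.1 hc⟩)

/-! ### Truncation of the variation in time -/

/-- The variation over the times in `[N, n]`. -/
noncomputable def clampVariation {X : Type*} (r : ℝ) (f : ℤ → X → ℝ) (N n : ℤ) (x : X) : ℝ≥0∞ :=
  rVariation r (fun m => f (max N (min n m))) x

/-- The variation over the times `≥ N`. -/
noncomputable def tailVariation {X : Type*} (r : ℝ) (f : ℤ → X → ℝ) (N : ℤ) (x : X) : ℝ≥0∞ :=
  rVariation r (fun m => f (max N m)) x

lemma clampVariation_mono {X : Type*} {r : ℝ} (hr : 0 < r) (f : ℤ → X → ℝ) (N : ℤ) (x : X)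
    {n n' : ℤ} (h : n ≤ n') : clampVariation r f N n x ≤ clampVariation r f N n' x := by
  have := rVariation_comp_le hr (fun m => f (max N (min n' m))) (φ := fun m => min n m)
    (fun _ _ hab => min_le_min_left _ hab) x
  simpa only [clampVariation, ← min_assoc, min_eq_right h] using this

lemma clampVariation_self {X : Type*} {r : ℝ} (hr : 0 < r) (f : ℤ → X → ℝ) (N : ℤ) (x : X) :
    clampVariation r f N N x = 0 := by
  simp [clampVariation, rVariation, hr]

lemma clampVariation_le_tailVariation {X : Type*} {r : ℝ} (hr : 0 < r) (f : ℤ → X → ℝ) (N n : ℤ)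
    (x : X) : clampVariation r f N n x ≤ tailVariation r f N x :=
  rVariation_comp_le hr (fun m => f (max N m)) (φ := fun m => min n m)
    (fun _ _ hab => min_le_min_left _ hab) x

lemma tailVariation_le {X : Type*} {r : ℝ} (hr : 0 < r) (f : ℤ → X → ℝ) (N : ℤ) (x : X) :
    tailVariation r f N x ≤ rVariation r f x :=
  rVariation_comp_le hr f (φ := fun m => max N m) (fun _ _ hab => max_le_max_left _ hab) x

lemma tailVariation_anti {X : Type*} {r : ℝ} (hr : 0 < r) (f : ℤ → X → ℝ) (x : X)
    {N N' : ℤ} (h : N ≤ N') : tailVariation r f N' x ≤ tailVariation r f N x := by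
  have := rVariation_comp_le hr (fun m => f (max N m)) (φ := fun m => max N' m)
    (fun _ _ hab => max_le_max_left _ hab) x
  simpa only [tailVariation, ← max_assoc, max_eq_right h] using this

/-- A finite sequence of times has a last one, so truncating there loses nothing. -/
lemma lt_tailVariation_iff {X : Type*} {r : ℝ} (hr : 0 < r) (f : ℤ → X → ℝ) (N : ℤ) (x : X)
    (a : ℝ≥0∞) : a < tailVariation r f N x ↔ ∃ n, N ≤ n ∧ a < clampVariation r f N n x := by
  refine ⟨fun h => ?_, fun ⟨n, _, h⟩ => h.trans_le (clampVariation_le_tailVariation hr f N n x)⟩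
  obtain ⟨J, n, hn, h⟩ := (lt_rVariation_iff hr _ x a).1 h
  refine ⟨max N (n (Fin.last J)), le_max_left _ _, (lt_rVariation_iff hr _ x a).2 ⟨J, n, hn, ?_⟩⟩
  have key : ∀ j, min (max N (n (Fin.last J))) (n j) = n j := fun j =>
    min_eq_right ((hn.monotone (Fin.le_last j)).trans (le_max_right _ _))
  simpa only [key] using h

lemma lt_rVariation_iff_tail {X : Type*} {r : ℝ} (hr : 0 < r) (f : ℤ → X → ℝ) (x : X)
    (a : ℝ≥0∞) : a < rVariation r f x ↔ ∃ i : ℕ, a < tailVariation r f (-(i : ℤ)) x := by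
  refine ⟨fun h => ?_, fun ⟨n, h⟩ => h.trans_le (tailVariation_le hr f _ x)⟩
  obtain ⟨J, n, hn, h⟩ := (lt_rVariation_iff hr _ x a).1 h
  refine ⟨(-(n 0)).toNat, (lt_rVariation_iff hr _ x a).2 ⟨J, n, hn, ?_⟩⟩
  have key : ∀ j, max (-((-(n 0)).toNat : ℤ)) (n j) = n j := fun j =>
    max_eq_right (le_trans (by omega) (hn.monotone (Fin.zero_le j)))
  simpa only [key] using h

lemma rVariation_eq_iSup_tail {X : Type*} {r : ℝ} (hr : 0 < r) (f : ℤ → X → ℝ) (x : X) :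
    rVariation r f x = ⨆ i : ℕ, tailVariation r f (-(i : ℤ)) x := by
  refine eq_of_forall_lt_iff fun a => ?_
  rw [lt_rVariation_iff_tail hr, lt_iSup_iff]

/-- Along a monotone sequence of times, a monotone counter increases at most as often as its
final value says. -/
lemma sum_ite_lt_le {α : Type*} [Preorder α] {c : α → ℕ} (hc : Monotone c) :
    ∀ (J : ℕ) (n : Fin (J + 1) → α), Monotone n →
    ∑ j : Fin J, (if c (n j.castSucc) < c (n j.succ) then 1 else 0) ≤ c (n (Fin.last J)) := by
  intro J
  induction J with
  | zero => simp
  | succ J ih =>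
    intro n hn
    have h := ih (fun i => n i.castSucc) (fun a b h => hn (Fin.castSucc_le_castSucc_iff.2 h))
    rw [Fin.sum_univ_castSucc]
    simp only [Fin.succ_castSucc, Fin.succ_last]
    have h2 : c (n (Fin.last J).castSucc) ≤ c (n (Fin.last (J + 1))) := hc (hn (Fin.le_last _))
    simp only [Nat.succ_eq_add_one]
    split_ifs <;> omega

/-! ### Greedy counting of jumps -/

/-- The anchor value and the number of jumps up to time `i`: a jump occurs, and the anchor moves
to the current value, when the sequence is at distance at least `μ` from the anchor. -/
noncomputable def greedyState (μ : ℝ) (u : ℕ → ℝ) : ℕ → ℝ × ℕ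
  | 0 => (u 0, 0)
  | i + 1 => if μ ≤ |u (i + 1) - (greedyState μ u i).1| then (u (i + 1), (greedyState μ u i).2 + 1)
      else greedyState μ u i

lemma greedyState_congr (μ : ℝ) {u v : ℕ → ℝ} {i : ℕ} (h : ∀ j ≤ i, u j = v j) :
    greedyState μ u i = greedyState μ v i := by
  induction i with
  | zero => simp [greedyState, h 0 le_rfl]
  | succ i ih => rw [greedyState, greedyState, ih fun j hj => h j (by omega), h (i + 1) le_rfl]

lemma exists_greedyState_fst_eq (μ : ℝ) (u : ℕ → ℝ) (i : ℕ) :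
    ∃ j ≤ i, (greedyState μ u i).1 = u j := by
  induction i with
  | zero => exact ⟨0, le_rfl, rfl⟩
  | succ i ih =>
    rw [greedyState]
    split_ifs
    · exact ⟨i + 1, le_rfl, rfl⟩
    · obtain ⟨j, hj, h⟩ := ih
      exact ⟨j, by omega, h⟩

lemma abs_sub_greedyState_lt {μ : ℝ} (hμ : 0 < μ) (u : ℕ → ℝ) (i : ℕ) :
    |u i - (greedyState μ u i).1| < μ := by
  cases i with
  | zero => simpa [greedyState] using hμ
  | succ i =>
    rw [greedyState]
    split_ifs with h
    · simpa using hμ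
    · exact not_le.1 h

lemma greedyState_snd_mono (μ : ℝ) (u : ℕ → ℝ) : Monotone fun i => (greedyState μ u i).2 := by
  refine monotone_nat_of_le_succ fun i => ?_
  rw [greedyState]
  split_ifs <;> simp

lemma greedyState_fst_eq_of_snd_eq (μ : ℝ) (u : ℕ → ℝ) {i k : ℕ} (hik : i ≤ k)
    (h : (greedyState μ u k).2 = (greedyState μ u i).2) :
    (greedyState μ u k).1 = (greedyState μ u i).1 := by
  induction k, hik using Nat.le_induction with
  | base => rfl
  | succ k hk ih =>
    have h1 := greedyState_snd_mono μ u hk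
    simp only at h1
    rw [greedyState] at h ⊢
    split_ifs at h ⊢ with hc
    · simp only at h
      omega
    · exact ih h

/-- Without a jump in between, both values lie within less than `μ` of the same anchor. -/
lemma greedyState_snd_lt {μ : ℝ} (hμ : 0 < μ) (u : ℕ → ℝ) {i k : ℕ} (hik : i ≤ k)
    (h : 2 * μ ≤ |u k - u i|) : (greedyState μ u i).2 < (greedyState μ u k).2 := by
  refine lt_of_le_of_ne (greedyState_snd_mono μ u hik) fun he => ?_
  have h1 := abs_lt.1 (abs_sub_greedyState_lt hμ u i)
  have h2 := abs_lt.1 (abs_sub_greedyState_lt hμ u k)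
  rw [greedyState_fst_eq_of_snd_eq μ u hik he.symm] at h2
  rcases le_abs.1 h with h | h <;> linarith [h1.1, h1.2, h2.1, h2.2]

/-- The potential `μ² · (number of jumps) + (distance to the anchor)²`. -/
noncomputable def greedyPotential (μ : ℝ) (u : ℕ → ℝ) (i : ℕ) : ℝ :=
  μ ^ 2 * (greedyState μ u i).2 + (u i - (greedyState μ u i).1) ^ 2

lemma greedyPotential_nonneg (μ : ℝ) (u : ℕ → ℝ) (i : ℕ) : 0 ≤ greedyPotential μ u i := by
  unfold greedyPotential; positivity

lemma greedyPotential_zero (μ : ℝ) (u : ℕ → ℝ) : greedyPotential μ u 0 = 0 := by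
  simp [greedyPotential, greedyState]

/-- Expand the new squared distance to the old anchor. At a jump it is at least `μ²`, which pays for
the new count while the distance resets to zero. -/
lemma greedyPotential_succ_le {μ : ℝ} (hμ : 0 < μ) (u : ℕ → ℝ) (i : ℕ) :
    greedyPotential μ u (i + 1) ≤ greedyPotential μ u i +
      2 * (u i - (greedyState μ u i).1) * (u (i + 1) - u i) + (u (i + 1) - u i) ^ 2 := by
  simp only [greedyPotential]
  rw [greedyState]
  split_ifs with h
  · have : μ ^ 2 ≤ (u (i + 1) - (greedyState μ u i).1) ^ 2 := by
      rw [← sq_abs (u (i + 1) - _)]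
      gcongr
    push_cast
    nlinarith
  · nlinarith

/-! ### From jump counts to variation sums -/

/-- A power of a bounded number is controlled by the dyadic thresholds it exceeds. -/
lemma ofReal_rpow_le_tsum_ite {r B y : ℝ} (hr : 0 < r) (hB : 0 < B) (hy : 0 ≤ y)
    (hyB : y ≤ 2 * B) :
    ENNReal.ofReal y ^ r ≤ ∑' k : ℕ, ENNReal.ofReal (2 * B * (1 / 2) ^ k) ^ r *
      (if 2 * (B * (1 / 2) ^ (k + 1)) ≤ y then 1 else 0) := by
  rcases hy.eq_or_lt with rfl | hy
  · simp [hr]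
  -- The single scale `k` with `2B · 2^{-k-1} < y ≤ 2B · 2^{-k}` already suffices.
  obtain ⟨k, h1, h2⟩ := exists_nat_pow_near_of_lt_one (x := y / (2 * B)) (y := (1 / 2 : ℝ))
    (by positivity) (by rw [div_le_one (by positivity)]; exact hyB) (by norm_num) (by norm_num)
  rw [lt_div_iff₀ (by positivity)] at h1
  rw [div_le_iff₀ (by positivity)] at h2
  refine le_trans ?_ (ENNReal.le_tsum k)
  rw [if_pos (by linarith), mul_one]
  gcongr
  linarith

/-- The variation sum of a bounded sequence is controlled by its greedy jump counts. -/
lemma sum_rpow_le_tsum_greedyState {r B : ℝ} (hr : 0 < r) (hB : 0 < B) (u : ℕ → ℝ) (i : ℕ)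
    (hu : ∀ j ≤ i, |u j| ≤ B) {J : ℕ} (n : Fin (J + 1) → ℕ) (hn : Monotone n)
    (hni : ∀ j, n j ≤ i) :
    ∑ j : Fin J, ‖u (n j.succ) - u (n j.castSucc)‖ₑ ^ r ≤
      ∑' k : ℕ, ENNReal.ofReal (2 * B * (1 / 2) ^ k) ^ r *
        ((greedyState (B * (1 / 2) ^ (k + 1)) u i).2 : ℝ≥0∞) := by
  calc ∑ j : Fin J, ‖u (n j.succ) - u (n j.castSucc)‖ₑ ^ r
      ≤ ∑ j : Fin J, ∑' k : ℕ, ENNReal.ofReal (2 * B * (1 / 2) ^ k) ^ r *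
          (if 2 * (B * (1 / 2) ^ (k + 1)) ≤ |u (n j.succ) - u (n j.castSucc)| then 1 else 0) := by
        refine Finset.sum_le_sum fun j _ => ?_
        rw [← ofReal_norm, Real.norm_eq_abs]
        refine ofReal_rpow_le_tsum_ite hr hB (abs_nonneg _) ?_
        calc _ ≤ |u (n j.succ)| + |u (n j.castSucc)| := abs_sub _ _
          _ ≤ 2 * B := by linarith [hu _ (hni j.succ), hu _ (hni j.castSucc)]
    _ = ∑' k : ℕ, ENNReal.ofReal (2 * B * (1 / 2) ^ k) ^ r * ∑ j : Fin J,
          (if 2 * (B * (1 / 2) ^ (k + 1)) ≤ |u (n j.succ) - u (n j.castSucc)| then 1 else 0) := by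
        simp only [Finset.mul_sum]
        exact (Summable.tsum_finsetSum fun _ _ => ENNReal.summable).symm
    _ ≤ _ := by
        refine ENNReal.tsum_le_tsum fun k => mul_le_mul_right ?_ _
        have hμ : 0 < B * (1 / 2) ^ (k + 1) := by positivity
        have h := (sum_ite_lt_le (greedyState_snd_mono (B * (1 / 2) ^ (k + 1)) u) J n hn).trans
          (greedyState_snd_mono (B * (1 / 2) ^ (k + 1)) u (hni (Fin.last J)))
        refine le_trans ?_ (Nat.cast_le.2 h)
        push_cast
        refine Finset.sum_le_sum fun j _ => ?_
        split_ifs with h1 h2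
        · exact le_rfl
        · exact absurd (greedyState_snd_lt hμ u (hn (Fin.castSucc_le_succ j)) h1) h2
        · exact zero_le_one
        · exact le_rfl

/-! ### Dyadic cubes -/

/-- The index of the dyadic cube of generation `n` that contains `x`. -/
noncomputable def dyadicIndex {d : ℕ} (n : ℤ) (x : Fin d → ℝ) : Fin d → ℤ :=
  fun i => ⌊x i / 2 ^ (-n)⌋

lemma mem_dyadicCube_iff {d : ℕ} {n : ℤ} {k : Fin d → ℤ} {x : Fin d → ℝ} :
    x ∈ dyadicCube n k ↔ dyadicIndex n x = k := by
  have hm : (0 : ℝ) < 2 ^ (-n) := by positivity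
  simp only [dyadicCube, Set.mem_ofPred_eq, funext_iff, dyadicIndex]
  refine forall_congr' fun i => ?_
  rw [Int.floor_eq_iff, le_div_iff₀ hm, div_lt_iff₀ hm]

lemma dyadicIndex_eq_of_le {d : ℕ} {m n : ℤ} (h : m ≤ n) {x y : Fin d → ℝ}
    (hxy : dyadicIndex n x = dyadicIndex n y) : dyadicIndex m x = dyadicIndex m y := by
  have hx : x ∈ dyadicCube m (dyadicIndex m x) := mem_dyadicCube_iff.2 rfl
  rw [dyadicCube_eq_iUnion h] at hx
  simp only [Set.mem_iUnion] at hx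
  obtain ⟨j, hj, hxj⟩ := hx
  refine (mem_dyadicCube_iff.1 (hj (mem_dyadicCube_iff.2 ?_))).symm
  rw [← hxy]
  exact mem_dyadicCube_iff.1 hxj

lemma dyadicCube_subset {d : ℕ} {m n : ℤ} (h : m ≤ n) {x : Fin d → ℝ} {k : Fin d → ℤ}
    (hx : x ∈ dyadicCube m k) : dyadicCube n (dyadicIndex n x) ⊆ dyadicCube m k := fun _ hy =>
  mem_dyadicCube_iff.2 ((dyadicIndex_eq_of_le h (mem_dyadicCube_iff.1 hy)).trans
    (mem_dyadicCube_iff.1 hx))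

lemma iUnion_dyadicCube {d : ℕ} (n : ℤ) : ⋃ k : Fin d → ℤ, dyadicCube n k = Set.univ :=
  Set.eq_univ_of_forall fun x => Set.mem_iUnion.2 ⟨dyadicIndex n x, mem_dyadicCube_iff.2 rfl⟩

lemma pairwise_disjoint_dyadicCube {d : ℕ} (n : ℤ) :
    Pairwise (Function.onFun Disjoint fun k : Fin d → ℤ => dyadicCube n k) := fun _ _ hab =>
  Set.disjoint_left.2 fun _ ha hb =>
    hab ((mem_dyadicCube_iff.1 ha).symm.trans (mem_dyadicCube_iff.1 hb))

lemma volume_dyadicCube {d : ℕ} (n : ℤ) (k : Fin d → ℤ) :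
    volume (dyadicCube n k) = ENNReal.ofReal (2 ^ (-n)) ^ d := by
  have : dyadicCube n k =
      Set.univ.pi fun i => Set.Ico ((k i : ℝ) * 2 ^ (-n)) (((k i : ℝ) + 1) * 2 ^ (-n)) := by
    ext x; simp [dyadicCube]
  rw [this, Real.volume_pi_Ico]
  simp [add_mul]

lemma volume_dyadicCube_ne_top {d : ℕ} (n : ℤ) (k : Fin d → ℤ) :
    volume (dyadicCube n k) ≠ ∞ := by
  rw [volume_dyadicCube]; exact ENNReal.pow_ne_top ENNReal.ofReal_ne_top

lemma volume_dyadicCube_succ {d : ℕ} (n : ℤ) (k k' : Fin d → ℤ) :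
    volume (dyadicCube n k) = 2 ^ d * volume (dyadicCube (n + 1) k') := by
  rw [volume_dyadicCube, volume_dyadicCube, ← mul_pow]
  congr 1
  rw [← ENNReal.ofReal_ofNat, ← ENNReal.ofReal_mul (by norm_num), neg_add,
    zpow_add₀ (by norm_num)]
  congr 1
  norm_num
  ring

lemma integrableOn_dyadicCube {d : ℕ} {g : (Fin d → ℝ) → ℝ} (hg : LocallyIntegrable g volume)
    (n : ℤ) (k : Fin d → ℤ) : IntegrableOn g (dyadicCube n k) := by
  refine (hg.integrableOn_isCompact (isCompact_Icc (a := fun i => (k i : ℝ) * 2 ^ (-n))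
    (b := fun i => ((k i : ℝ) + 1) * 2 ^ (-n)))).mono_set fun x hx => ?_
  exact ⟨fun i => (hx i).1, fun i => (hx i).2.le⟩

/-! ### Functions constant on cubes, and measurability -/

/-- `g` is constant on the dyadic cubes of generation `n`. -/
def CubeConst {d : ℕ} {β : Type*} (n : ℤ) (g : (Fin d → ℝ) → β) : Prop :=
  ∀ x y, dyadicIndex n x = dyadicIndex n y → g x = g y

lemma CubeConst.mono {d : ℕ} {β : Type*} {m n : ℤ} (h : m ≤ n) {g : (Fin d → ℝ) → β}
    (hg : CubeConst m g) : CubeConst n g := fun x y hxy => hg x y (dyadicIndex_eq_of_le h hxy)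

lemma measurable_dyadicIndex {d : ℕ} (n : ℤ) :
    Measurable (dyadicIndex n : (Fin d → ℝ) → Fin d → ℤ) :=
  measurable_pi_lambda _ fun i => Int.measurable_floor.comp ((measurable_pi_apply i).div_const _)

lemma CubeConst.exists_eq_comp {d : ℕ} {β : Type*} {n : ℤ} {g : (Fin d → ℝ) → β}
    (hg : CubeConst n g) : ∃ h : (Fin d → ℤ) → β, g = h ∘ dyadicIndex n := by
  refine ⟨fun k => g fun i => (k i : ℝ) * 2 ^ (-n), funext fun x => hg _ _ (funext fun i => ?_)⟩
  have hm : (2 : ℝ) ^ (-n) ≠ 0 := by positivity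
  simp only [dyadicIndex, mul_div_cancel_right₀ _ hm, Int.floor_intCast]

/-- The function factors through the countable discrete space of indices. Thus cube hulls and jump
counts are measurable without any assumption on the set `G`. -/
lemma CubeConst.measurable {d : ℕ} {β : Type*} [MeasurableSpace β] {n : ℤ}
    {g : (Fin d → ℝ) → β} (hg : CubeConst n g) : Measurable g := by
  obtain ⟨h, rfl⟩ := hg.exists_eq_comp
  exact (Measurable.of_discrete (f := h)).comp (measurable_dyadicIndex n)

lemma cubeConst_of_measurable {d : ℕ} {n : ℤ} {g : (Fin d → ℝ) → ℝ}
    (hg : Measurable[dyadicFiltration d n] g) : CubeConst n g := by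
  intro x y hxy
  have hle : dyadicFiltration d n ≤ MeasurableSpace.comap (dyadicIndex n) ⊤ := by
    refine MeasurableSpace.generateFrom_le ?_
    rintro _ ⟨k, rfl⟩
    refine ⟨{k}, trivial, ?_⟩
    ext z
    simp [mem_dyadicCube_iff]
  obtain ⟨t, -, ht⟩ := hle _ (hg (measurableSet_singleton (g x)))
  have hx : x ∈ dyadicIndex n ⁻¹' t := by rw [ht]; rfl
  have hy : y ∈ dyadicIndex n ⁻¹' t := by
    rw [Set.mem_preimage, ← hxy]
    exact hx
  rw [ht] at hy
  exact hy.symm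

lemma IsDyadicMartingale.cubeConst {d : ℕ} {f : ℤ → (Fin d → ℝ) → ℝ} (hf : IsDyadicMartingale f)
    (n : ℤ) : CubeConst n (f n) := cubeConst_of_measurable (hf.adapted n)

lemma IsDyadicMartingale.measurable {d : ℕ} {f : ℤ → (Fin d → ℝ) → ℝ} (hf : IsDyadicMartingale f)
    (n : ℤ) : Measurable (f n) := (hf.cubeConst n).measurable

lemma measurable_rVariation {X : Type*} [MeasurableSpace X] (r : ℝ) {f : ℤ → X → ℝ}
    (hf : ∀ n, Measurable (f n)) : Measurable (rVariation r f) := by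
  refine Measurable.iSup fun J => Measurable.iSup fun n => Measurable.iSup fun _ => ?_
  refine (Finset.measurable_sum _ fun j _ => ?_).pow_const _
  exact ((hf _).sub (hf _)).enorm.pow_const _

lemma measurable_maximalFunction {X : Type*} [MeasurableSpace X] {f : ℤ → X → ℝ}
    (hf : ∀ n, Measurable (f n)) : Measurable (maximalFunction f) :=
  Measurable.iSup fun n => (hf n).enorm

lemma measurable_squareFunction {X : Type*} [MeasurableSpace X] {f : ℤ → X → ℝ}
    (hf : ∀ n, Measurable (f n)) : Measurable (squareFunction f) :=
  (Measurable.tsum fun n => ((hf n).sub (hf (n - 1))).enorm.pow_const 2).pow_const _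

lemma measurable_tailVariation {X : Type*} [MeasurableSpace X] (r : ℝ) {f : ℤ → X → ℝ}
    (hf : ∀ n, Measurable (f n)) (N : ℤ) : Measurable (tailVariation r f N) :=
  measurable_rVariation r (f := fun m => f (max N m)) fun m => hf (max N m)

/-- All clamped times are at most `n`. Hence the set where the variation first passes a level at
generation `n` is a union of cubes of that generation. -/
lemma IsDyadicMartingale.cubeConst_clampVariation {d : ℕ} {f : ℤ → (Fin d → ℝ) → ℝ}
    (hf : IsDyadicMartingale f) (r : ℝ) {N n : ℤ} (h : N ≤ n) :
    CubeConst n (clampVariation r f N n) := by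
  intro x y hxy
  have : ∀ m, f (max N (min n m)) x = f (max N (min n m)) y := fun m =>
    (hf.cubeConst _).mono (max_le h (min_le_left _ _)) x y hxy
  simp only [clampVariation, rVariation, this]

/-! ### Decomposition over the cubes of one generation -/

lemma tsum_measure_inter_dyadicCube {d : ℕ} (ν : Measure (Fin d → ℝ)) (n : ℤ)
    {s : Set (Fin d → ℝ)} (hs : MeasurableSet s) : ∑' k, ν (s ∩ dyadicCube n k) = ν s := by
  rw [← measure_iUnion, ← Set.inter_iUnion, iUnion_dyadicCube, Set.inter_univ]
  · exact fun i j hij => (pairwise_disjoint_dyadicCube n hij).mono Set.inter_subset_right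
      Set.inter_subset_right
  · exact fun k => hs.inter (measurableSet_dyadicCube n k)

lemma measure_le_tsum_inter_dyadicCube {d : ℕ} (ν : Measure (Fin d → ℝ)) (n : ℤ)
    (s : Set (Fin d → ℝ)) : ν s ≤ ∑' k, ν (s ∩ dyadicCube n k) := by
  refine le_trans (le_of_eq ?_) (measure_iUnion_le _)
  rw [← Set.inter_iUnion, iUnion_dyadicCube, Set.inter_univ]

lemma setLIntegral_eq_tsum_dyadicCube {d : ℕ} (ν : Measure (Fin d → ℝ)) (n : ℤ)
    {s : Set (Fin d → ℝ)} (hs : MeasurableSet s) (g : (Fin d → ℝ) → ℝ≥0∞) :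
    ∫⁻ x in s, g x ∂ν = ∑' k, ∫⁻ x in s ∩ dyadicCube n k, g x ∂ν := by
  rw [← lintegral_iUnion, ← Set.inter_iUnion, iUnion_dyadicCube, Set.inter_univ]
  · exact fun k => hs.inter (measurableSet_dyadicCube n k)
  · exact fun i j hij => (pairwise_disjoint_dyadicCube n hij).mono Set.inter_subset_right
      Set.inter_subset_right

/-! ### The expected number of jumps -/

/-- The union of the dyadic cubes of generation `n` that meet `G`. -/
def cubeHull {d : ℕ} (n : ℤ) (G : Set (Fin d → ℝ)) : Set (Fin d → ℝ) :=
  {x | ∃ y ∈ G, dyadicIndex n y = dyadicIndex n x}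

lemma subset_cubeHull {d : ℕ} (n : ℤ) (G : Set (Fin d → ℝ)) : G ⊆ cubeHull n G :=
  fun x hx => ⟨x, hx, rfl⟩

lemma cubeHull_anti {d : ℕ} {m n : ℤ} (h : m ≤ n) (G : Set (Fin d → ℝ)) :
    cubeHull n G ⊆ cubeHull m G := fun _ ⟨y, hy, hxy⟩ => ⟨y, hy, dyadicIndex_eq_of_le h hxy⟩

lemma cubeConst_mem_cubeHull {d : ℕ} (n : ℤ) (G : Set (Fin d → ℝ)) :
    CubeConst n fun x => x ∈ cubeHull n G := fun x y hxy => by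
  simp only [cubeHull, Set.mem_ofPred_eq, hxy]

lemma measurableSet_cubeHull {d : ℕ} (n : ℤ) (G : Set (Fin d → ℝ)) :
    MeasurableSet (cubeHull n G) := measurableSet_setOfPred.2 (cubeConst_mem_cubeHull n G).measurable

lemma cubeHull_subset_dyadicCube {d : ℕ} {m n : ℤ} (h : m ≤ n) {k : Fin d → ℤ}
    {G : Set (Fin d → ℝ)} (hG : G ⊆ dyadicCube m k) : cubeHull n G ⊆ dyadicCube m k :=
  fun _ ⟨_, hy, hxy⟩ => mem_dyadicCube_iff.2
    ((dyadicIndex_eq_of_le h hxy.symm).trans (mem_dyadicCube_iff.1 (hG hy)))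

/-- The greedy potential with the quadratic variation compensated and a reserve `K` added. -/
noncomputable def compensatedPotential (μ K : ℝ) (u : ℕ → ℝ) (i : ℕ) : ℝ :=
  greedyPotential μ u i + (K - ∑ j ∈ Finset.range i, (u (j + 1) - u j) ^ 2)

lemma compensatedPotential_congr (μ K : ℝ) {u v : ℕ → ℝ} {i : ℕ} (h : ∀ j ≤ i, u j = v j) :
    compensatedPotential μ K u i = compensatedPotential μ K v i := by
  have : ∑ j ∈ Finset.range i, (u (j + 1) - u j) ^ 2 =
      ∑ j ∈ Finset.range i, (v (j + 1) - v j) ^ 2 :=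
    Finset.sum_congr rfl fun j hj => by
      rw [h j (Finset.mem_range.1 hj).le, h (j + 1) (Finset.mem_range.1 hj)]
  rw [compensatedPotential, compensatedPotential, greedyPotential, greedyPotential, this,
    greedyState_congr μ h, h i le_rfl]

lemma compensatedPotential_succ_le {μ : ℝ} (hμ : 0 < μ) (K : ℝ) (u : ℕ → ℝ) (i : ℕ) :
    compensatedPotential μ K u (i + 1) ≤ compensatedPotential μ K u i +
      2 * (u i - (greedyState μ u i).1) * (u (i + 1) - u i) := by
  have := greedyPotential_succ_le hμ u i
  rw [compensatedPotential, compensatedPotential, Finset.sum_range_succ]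
  linarith

/-- The values of `f` at the times `≥ n`, as a sequence. -/
def shiftSeq {d : ℕ} (f : ℤ → (Fin d → ℝ) → ℝ) (n : ℤ) (x : Fin d → ℝ) : ℕ → ℝ :=
  fun i => f (n + i) x

lemma IsDyadicMartingale.shiftSeq_eq {d : ℕ} {f : ℤ → (Fin d → ℝ) → ℝ}
    (hf : IsDyadicMartingale f) {n : ℤ} {i : ℕ} {x y : Fin d → ℝ}
    (hxy : dyadicIndex (n + i) x = dyadicIndex (n + i) y) :
    ∀ j ≤ i, shiftSeq f n x j = shiftSeq f n y j := fun j hj =>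
  (hf.cubeConst (n + j)).mono (by omega) x y hxy

lemma IsDyadicMartingale.cubeConst_compensatedPotential {d : ℕ} {f : ℤ → (Fin d → ℝ) → ℝ}
    (hf : IsDyadicMartingale f) (μ K : ℝ) (n : ℤ) (i : ℕ) :
    CubeConst (n + i) fun x => compensatedPotential μ K (shiftSeq f n x) i := fun _ _ hxy =>
  compensatedPotential_congr μ K (hf.shiftSeq_eq hxy)

lemma IsDyadicMartingale.cubeConst_greedyState {d : ℕ} {f : ℤ → (Fin d → ℝ) → ℝ}
    (hf : IsDyadicMartingale f) (μ : ℝ) (n : ℤ) (i : ℕ) :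
    CubeConst (n + i) fun x => greedyState μ (shiftSeq f n x) i := fun _ _ hxy =>
  greedyState_congr μ (hf.shiftSeq_eq hxy)

/-- The maximal function and the square function from time `n` on are bounded by `B`. -/
structure ControlledAt (B : ℝ) (u : ℕ → ℝ) : Prop where
  abs_le : ∀ i, |u i| ≤ B
  sum_sq_le : ∀ i, ∑ j ∈ Finset.range i, (u (j + 1) - u j) ^ 2 ≤ B ^ 2

section Step

variable {d : ℕ} {f : ℤ → (Fin d → ℝ) → ℝ} {n : ℤ} {G : Set (Fin d → ℝ)} {B : ℝ}

/-- The cube of `x` contains a point of `G` with the same values up to time `n + i`, so bounds on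
`G` spread to the hull. -/
lemma IsDyadicMartingale.abs_le_of_mem_cubeHull (hf : IsDyadicMartingale f)
    (hG : ∀ y ∈ G, ControlledAt B (shiftSeq f n y)) {i : ℕ} {x : Fin d → ℝ}
    (hx : x ∈ cubeHull (n + i) G) : ∀ j ≤ i, |shiftSeq f n x j| ≤ B := by
  obtain ⟨y, hy, hxy⟩ := hx
  intro j hj
  rw [← hf.shiftSeq_eq hxy j hj]
  exact (hG y hy).abs_le j

/-- The share `B ^ 2` of the reserve absorbs the subtracted quadratic variation, so `K` stays
available on every surviving cube. -/
lemma IsDyadicMartingale.le_compensatedPotential (hf : IsDyadicMartingale f)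
    (hG : ∀ y ∈ G, ControlledAt B (shiftSeq f n y)) (μ K : ℝ) {i : ℕ} {x : Fin d → ℝ}
    (hx : x ∈ cubeHull (n + i) G) :
    greedyPotential μ (shiftSeq f n x) i + K ≤
      compensatedPotential μ (B ^ 2 + K) (shiftSeq f n x) i := by
  obtain ⟨y, hy, hxy⟩ := hx
  have h : ∑ j ∈ Finset.range i, (shiftSeq f n x (j + 1) - shiftSeq f n x j) ^ 2 ≤ B ^ 2 := by
    refine le_trans (le_of_eq ?_) ((hG y hy).sum_sq_le i)
    refine Finset.sum_congr rfl fun j hj => ?_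
    have := Finset.mem_range.1 hj
    rw [hf.shiftSeq_eq hxy j (by omega), hf.shiftSeq_eq hxy (j + 1) (by omega)]
  rw [compensatedPotential]
  linarith

lemma IsDyadicMartingale.abs_sub_greedyState_le (hf : IsDyadicMartingale f)
    (hG : ∀ y ∈ G, ControlledAt B (shiftSeq f n y)) (μ : ℝ) {i : ℕ} {x : Fin d → ℝ}
    (hx : x ∈ cubeHull (n + i) G) :
    |shiftSeq f n x i - (greedyState μ (shiftSeq f n x) i).1| ≤ 2 * B := by
  obtain ⟨j, hj, h⟩ := exists_greedyState_fst_eq μ (shiftSeq f n x) i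
  have h1 := hf.abs_le_of_mem_cubeHull hG hx j hj
  have h2 := hf.abs_le_of_mem_cubeHull hG hx i le_rfl
  rw [h]
  exact (abs_sub _ _).trans (by linarith)

/-- The integral of the compensated potential over the cubes that meet `G` decreases, on each
cube `Q` of the coarser generation: if all children of `Q` meet `G` this is the martingale
property, otherwise the reserve set free on the lost child pays for the increase elsewhere. -/
lemma IsDyadicMartingale.setLIntegral_compensatedPotential_succ_le_cube
    (hf : IsDyadicMartingale f) (hB : 0 < B)
    (hG : ∀ y ∈ G, ControlledAt B (shiftSeq f n y)) {μ : ℝ} (hμ : 0 < μ) (i : ℕ)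
    (k : Fin d → ℤ) :
    ∫⁻ x in cubeHull (n + (i + 1 : ℕ)) G ∩ dyadicCube (n + i) k, ENNReal.ofReal
        (compensatedPotential μ (B ^ 2 + 2 ^ d * (8 * B ^ 2)) (shiftSeq f n x) (i + 1)) ≤
      ∫⁻ x in cubeHull (n + i) G ∩ dyadicCube (n + i) k, ENNReal.ofReal
        (compensatedPotential μ (B ^ 2 + 2 ^ d * (8 * B ^ 2)) (shiftSeq f n x) i) := by
  set K : ℝ := 2 ^ d * (8 * B ^ 2) with hK
  set A := cubeHull (n + i) G with hA
  set A' := cubeHull (n + (i + 1 : ℕ)) G with hA'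
  set Q := dyadicCube (n + i) k with hQ
  have hAm : MeasurableSet A := measurableSet_cubeHull _ _
  have hA'm : MeasurableSet A' := measurableSet_cubeHull _ _
  have hQm : MeasurableSet Q := measurableSet_dyadicCube _ _
  have hAA : A' ⊆ A := cubeHull_anti (by omega) G
  rcases (A' ∩ Q).eq_empty_or_nonempty with he | ⟨x₀, hx₀, hx₀Q⟩
  · simp [he]
  have hQA : Q ⊆ A := fun x hx => by
    have : (x ∈ A) = (x₀ ∈ A) := cubeConst_mem_cubeHull (n + i) G x x₀
      ((mem_dyadicCube_iff.1 hx).trans (mem_dyadicCube_iff.1 hx₀Q).symm)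
    rw [this]
    exact hAA hx₀
  rw [Set.inter_eq_right.2 hQA]
  set θ := compensatedPotential μ (B ^ 2 + K) (shiftSeq f n x₀) i with hθ
  set h := shiftSeq f n x₀ i - (greedyState μ (shiftSeq f n x₀) i).1 with hh
  have hKθ : K ≤ θ := by
    have := hf.le_compensatedPotential hG μ K (hAA hx₀)
    linarith [greedyPotential_nonneg μ (shiftSeq f n x₀) i]
  have hK0 : 0 ≤ K := by positivity
  have hhB : |h| ≤ 2 * B := hf.abs_sub_greedyState_le hG μ (hAA hx₀)
  have hidx : ∀ x ∈ Q, dyadicIndex (n + i) x = dyadicIndex (n + i) x₀ := fun x hx =>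
    (mem_dyadicCube_iff.1 hx).trans (mem_dyadicCube_iff.1 hx₀Q).symm
  have hconst : ∀ x ∈ Q, compensatedPotential μ (B ^ 2 + K) (shiftSeq f n x) i = θ := fun x hx =>
    hf.cubeConst_compensatedPotential μ _ n i x x₀ (hidx x hx)
  have hstep : ∀ x ∈ Q, compensatedPotential μ (B ^ 2 + K) (shiftSeq f n x) (i + 1) ≤
      θ + 2 * h * (f (n + (i + 1 : ℕ)) x - f (n + i) x) := fun x hx => by
    have h1 := compensatedPotential_succ_le hμ (B ^ 2 + K) (shiftSeq f n x) i
    have h2 := hf.cubeConst_greedyState μ n i x x₀ (hidx x hx)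
    simp only at h2
    rw [hconst x hx, h2, hf.shiftSeq_eq (hidx x hx) i le_rfl, ← hh,
      ← hf.shiftSeq_eq (hidx x hx) i le_rfl] at h1
    exact h1
  have hRHS : ∫⁻ x in Q, ENNReal.ofReal
      (compensatedPotential μ (B ^ 2 + K) (shiftSeq f n x) i) = ENNReal.ofReal θ * volume Q := by
    rw [setLIntegral_congr_fun hQm (g := fun _ => ENNReal.ofReal θ)
      fun x hx => by simp only [hconst x hx], setLIntegral_const]
  rw [hRHS]
  by_cases hall : Q ⊆ A'
  · rw [Set.inter_eq_right.2 hall]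
    have hint1 := integrableOn_dyadicCube (hf.locallyIntegrable (n + (i + 1 : ℕ))) (n + i) k
    have hint0 := integrableOn_dyadicCube (hf.locallyIntegrable (n + i)) (n + i) k
    have hintθ : IntegrableOn (fun _ => θ) Q volume :=
      integrableOn_const (volume_dyadicCube_ne_top _ _)
    have hint : IntegrableOn (fun x => 2 * h * (f (n + (i + 1 : ℕ)) x - f (n + i) x)) Q :=
      (hint1.sub hint0).const_mul _
    calc _ ≤ ∫⁻ x in Q, ENNReal.ofReal (θ + 2 * h * (f (n + (i + 1 : ℕ)) x - f (n + i) x)) :=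
          setLIntegral_mono' hQm fun x hx => ENNReal.ofReal_le_ofReal (hstep x hx)
      _ = ENNReal.ofReal (∫ x in Q, (θ + 2 * h * (f (n + (i + 1 : ℕ)) x - f (n + i) x))) := by
          -- The integrand is nonnegative because it dominates the next potential, and all of `Q` is
          -- still in the hull.
          refine (ofReal_integral_eq_lintegral_ofReal (hintθ.add hint) ?_).symm
          refine (ae_restrict_iff' hQm).2 (Filter.Eventually.of_forall fun x hx => ?_)
          refine le_trans ?_ (hstep x hx)
          have := hf.le_compensatedPotential hG μ K (hall hx)
          have h0 := greedyPotential_nonneg μ (shiftSeq f n x) (i + 1)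
          exact (add_nonneg h0 hK0).trans this
      _ = ENNReal.ofReal θ * volume Q := by
          rw [integral_add hintθ hint, integral_const_mul, integral_sub hint1 hint0,
            hf.setIntegral_eq _ _ (by omega), sub_self, mul_zero, add_zero, setIntegral_const,
            smul_eq_mul, mul_comm, ENNReal.ofReal_mul (hK0.trans hKθ), Measure.real,
            ENNReal.ofReal_toReal (volume_dyadicCube_ne_top _ _)]
      _ ≤ _ := le_rfl
  · obtain ⟨x₁, hx₁Q, hx₁⟩ := Set.not_subset.1 hall
    have hchild : dyadicCube (n + i + 1) (dyadicIndex (n + i + 1) x₁) ⊆ Q \ A' := by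
      refine fun x hx => ⟨dyadicCube_subset (by omega) hx₁Q hx, fun hxA => hx₁ ?_⟩
      have : (x₁ ∈ A') = (x ∈ A') := cubeConst_mem_cubeHull (n + (i + 1 : ℕ)) G x₁ x (by
        rw [Nat.cast_succ, ← add_assoc]
        exact (mem_dyadicCube_iff.1 hx).symm)
      rw [this]
      exact hxA
    have hvol : volume Q ≤ 2 ^ d * volume (Q \ A') := by
      rw [hQ, volume_dyadicCube_succ (n + i) k (dyadicIndex (n + i + 1) x₁)]
      gcongr
    -- The bound `8 * B ^ 2` is twice a distance to the anchor times an increment, each at most `2 *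
    -- B`.
    have hpt : ∀ x ∈ A' ∩ Q, compensatedPotential μ (B ^ 2 + K) (shiftSeq f n x) (i + 1) ≤
        θ + 8 * B ^ 2 := fun x hx => by
      refine (hstep x hx.2).trans (add_le_add_right ?_ _)
      have h1 := hf.abs_le_of_mem_cubeHull hG hx.1 (i + 1) le_rfl
      have h2 := hf.abs_le_of_mem_cubeHull hG hx.1 i (by omega)
      have h3 : |f (n + (i + 1 : ℕ)) x - f (n + i) x| ≤ 2 * B :=
        (abs_sub _ _).trans (by simp only [shiftSeq] at h1 h2; linarith)
      calc _ ≤ |2 * h * (f (n + (i + 1 : ℕ)) x - f (n + i) x)| := le_abs_self _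
        _ = 2 * (|h| * |f (n + (i + 1 : ℕ)) x - f (n + i) x|) := by
            rw [abs_mul, abs_mul, abs_two, mul_assoc]
        _ ≤ 2 * (2 * B * (2 * B)) := by gcongr
        _ = 8 * B ^ 2 := by ring
    calc _ ≤ ∫⁻ x in A' ∩ Q, ENNReal.ofReal (θ + 8 * B ^ 2) :=
          setLIntegral_mono' (hA'm.inter hQm) fun x hx => ENNReal.ofReal_le_ofReal (hpt x hx)
      _ = ENNReal.ofReal θ * volume (A' ∩ Q) + ENNReal.ofReal (8 * B ^ 2) * volume (A' ∩ Q) := by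
          rw [setLIntegral_const, ENNReal.ofReal_add (hK0.trans hKθ) (by positivity), add_mul]
      _ ≤ ENNReal.ofReal θ * volume (A' ∩ Q) +
          ENNReal.ofReal (8 * B ^ 2) * (2 ^ d * volume (Q \ A')) := by
          gcongr
          exact (measure_mono Set.inter_subset_right).trans hvol
      _ = ENNReal.ofReal θ * volume (A' ∩ Q) + ENNReal.ofReal K * volume (Q \ A') := by
          rw [hK, ENNReal.ofReal_mul (p := 2 ^ d) (by positivity),
            ENNReal.ofReal_pow (p := 2) (by norm_num), ENNReal.ofReal_ofNat]
          ring
      _ ≤ ENNReal.ofReal θ * volume (A' ∩ Q) + ENNReal.ofReal θ * volume (Q \ A') := by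
          gcongr
      _ = ENNReal.ofReal θ * volume Q := by
          rw [← mul_add, Set.inter_comm, measure_inter_add_sdiff Q hA'm]

lemma IsDyadicMartingale.setLIntegral_compensatedPotential_le (hf : IsDyadicMartingale f)
    (hB : 0 < B) (hG : ∀ y ∈ G, ControlledAt B (shiftSeq f n y)) {μ : ℝ} (hμ : 0 < μ)
    {k : Fin d → ℤ} (hGk : G ⊆ dyadicCube n k) (i : ℕ) :
    ∫⁻ x in cubeHull (n + i) G, ENNReal.ofReal
        (compensatedPotential μ (B ^ 2 + 2 ^ d * (8 * B ^ 2)) (shiftSeq f n x) i) ≤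
      ENNReal.ofReal (B ^ 2 + 2 ^ d * (8 * B ^ 2)) * volume (dyadicCube n k) := by
  induction i with
  | zero =>
    simp only [compensatedPotential, greedyPotential_zero, Finset.range_zero, Finset.sum_empty,
      sub_zero, zero_add, setLIntegral_const]
    gcongr
    exact cubeHull_subset_dyadicCube (by simp) hGk
  | succ i ih =>
    refine le_trans ?_ ih
    rw [setLIntegral_eq_tsum_dyadicCube volume (n + i) (measurableSet_cubeHull _ _),
      setLIntegral_eq_tsum_dyadicCube volume (n + i) (measurableSet_cubeHull _ _)]
    exact ENNReal.tsum_le_tsum fun k =>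
      hf.setLIntegral_compensatedPotential_succ_le_cube hB hG hμ i k

/-- The number of jumps of size `μ`, integrated over the cubes that meet `G`. -/
lemma IsDyadicMartingale.setLIntegral_greedyState_le (hf : IsDyadicMartingale f)
    (hB : 0 < B) (hG : ∀ y ∈ G, ControlledAt B (shiftSeq f n y)) {μ : ℝ} (hμ : 0 < μ)
    {k : Fin d → ℤ} (hGk : G ⊆ dyadicCube n k) (i : ℕ) :
    ∫⁻ x in cubeHull (n + i) G, ((greedyState μ (shiftSeq f n x) i).2 : ℝ≥0∞) ≤
      ENNReal.ofReal ((1 + 8 * 2 ^ d) * (B / μ) ^ 2) * volume (dyadicCube n k) := by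
  have hμ2 : 0 < μ ^ 2 := by positivity
  have h1 : ENNReal.ofReal (μ ^ 2) *
      ∫⁻ x in cubeHull (n + i) G, ((greedyState μ (shiftSeq f n x) i).2 : ℝ≥0∞) ≤
      ENNReal.ofReal (B ^ 2 + 2 ^ d * (8 * B ^ 2)) * volume (dyadicCube n k) := by
    rw [← lintegral_const_mul' _ _ ENNReal.ofReal_ne_top]
    refine le_trans (setLIntegral_mono' (measurableSet_cubeHull _ _) fun x hx => ?_)
      (hf.setLIntegral_compensatedPotential_le hB hG hμ hGk i)
    rw [← ENNReal.ofReal_natCast, ← ENNReal.ofReal_mul hμ2.le]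
    refine ENNReal.ofReal_le_ofReal (le_trans ?_ (hf.le_compensatedPotential hG μ _ hx))
    rw [greedyPotential]
    have := sq_nonneg (shiftSeq f n x i - (greedyState μ (shiftSeq f n x) i).1)
    have : 0 ≤ (2 : ℝ) ^ d * (8 * B ^ 2) := by positivity
    linarith
  have h2 : B ^ 2 + 2 ^ d * (8 * B ^ 2) = μ ^ 2 * ((1 + 8 * 2 ^ d) * (B / μ) ^ 2) := by
    field_simp
  rw [h2, ENNReal.ofReal_mul hμ2.le, mul_assoc] at h1
  exact (ENNReal.mul_le_mul_iff_right (ENNReal.ofReal_pos.2 hμ2).ne' ENNReal.ofReal_ne_top).1 h1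

end Step

/-! ### The local good-`λ` inequality -/

/-- The sum of the greedy jump counts over the dyadic thresholds, weighted as in the `r`-variation
of a sequence bounded by `B`. -/
noncomputable def weightedJumpCount (r B : ℝ) (u : ℕ → ℝ) (i : ℕ) : ℝ≥0∞ :=
  ∑' k : ℕ, ENNReal.ofReal (2 * B * (1 / 2) ^ k) ^ r *
    ((greedyState (B * (1 / 2) ^ (k + 1)) u i).2 : ℝ≥0∞)

/-- Splitting the variation at time `n`: before, across, and after `n`. -/
lemma rpow_lt_of_lt_clampVariation {d : ℕ} {r B : ℝ} (hr : 0 < r) (hB : 0 < B)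
    {f : ℤ → (Fin d → ℝ) → ℝ} {x : Fin d → ℝ} (hM : ∀ m, |f m x| ≤ B) {N n : ℤ} (hNn : N < n)
    (i : ℕ) {a b : ℝ≥0∞} (ha : clampVariation r f N (n - 1) x ≤ a)
    (hb : b < clampVariation r f N (n + i) x) :
    b ^ r < a ^ r + weightedJumpCount r B (shiftSeq f n x) i + ENNReal.ofReal (2 * B) ^ r := by
  obtain ⟨J, t, ht, hlt⟩ := (lt_rVariation_iff hr _ x b).1 hb
  refine hlt.trans_le ?_
  have h1 := sum_rpow_le_of_rVariation_le hr ha ht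
  -- Clamped times counted from `n`; those before `n` collapse to `0`.
  set p : Fin (J + 1) → ℕ := fun j => (max N (min (n + i) (t j)) - n).toNat with hp
  have hpm : Monotone p := fun j j' hj => by
    have := ht.monotone hj
    simp only [hp]
    omega
  have h3 := sum_rpow_le_tsum_greedyState hr hB (shiftSeq f n x) i (fun j _ => hM _) p hpm
    (fun j => by simp only [hp]; omega)
  -- A counter with values `0` and `1` shows that at most one increment crosses `n`.
  have h2 := sum_ite_lt_le (c := fun m : ℤ => if n ≤ m then 1 else 0)
    (fun a b hab => by dsimp only; split_ifs <;> omega) J t ht.monotone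
  have h2' : ∑ j : Fin J, ENNReal.ofReal (2 * B) ^ r *
      (if t j.castSucc < n ∧ n ≤ t j.succ then 1 else 0) ≤ ENNReal.ofReal (2 * B) ^ r := by
    rw [← Finset.mul_sum]
    refine mul_le_of_le_one_right (zero_le) ?_
    have h4 : ∑ j : Fin J, (if t j.castSucc < n ∧ n ≤ t j.succ then 1 else 0) ≤ 1 := by
      refine (Finset.sum_le_sum fun j _ => ?_).trans (h2.trans (by split_ifs <;> simp))
      split_ifs <;> omega
    exact_mod_cast h4
  refine le_trans ?_ (add_le_add (add_le_add h1 h3) h2')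
  rw [← Finset.sum_add_distrib, ← Finset.sum_add_distrib]
  refine Finset.sum_le_sum fun j _ => ?_
  have hj : t j.castSucc < t j.succ := ht Fin.castSucc_lt_succ
  by_cases hc1 : t j.succ < n
  · refine le_add_right (le_add_right (le_of_eq ?_))
    have e : ∀ m, m < n → max N (min (n + i) m) = max N (min (n - 1) m) := fun m hm => by omega
    simp only [e _ hc1, e _ (hj.trans hc1)]
  by_cases hc2 : n ≤ t j.castSucc
  · refine le_add_right (le_add_left (le_of_eq ?_))
    have e : ∀ j, n ≤ t j → f (max N (min (n + i) (t j))) x = shiftSeq f n x (p j) := fun j hj => by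
      simp only [shiftSeq, hp]
      congr 1
      omega
    rw [e _ hc2, e _ (hc2.trans hj.le)]
  · refine le_add_left ?_
    rw [if_pos ⟨not_le.1 hc2, not_lt.1 hc1⟩, mul_one, ← ofReal_norm, Real.norm_eq_abs]
    gcongr
    refine (abs_sub _ _).trans ?_
    linarith [hM (max N (min (n + i) (t j.succ))), hM (max N (min (n + i) (t j.castSucc)))]

/-- The constant in the variation estimate. -/
noncomputable def jumpConst (d : ℕ) (r : ℝ) : ℝ :=
  2 ^ r * (4 * (1 + 8 * 2 ^ d)) * (1 - 2 ^ (2 - r))⁻¹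

lemma two_rpow_sub_lt_one {r : ℝ} (hr : 2 < r) : (2 : ℝ) ^ (2 - r) < 1 :=
  Real.rpow_lt_one_of_one_lt_of_neg (by norm_num) (by linarith)

lemma jumpConst_pos (d : ℕ) {r : ℝ} (hr : 2 < r) : 0 < jumpConst d r := by
  have := sub_pos.2 (two_rpow_sub_lt_one hr)
  unfold jumpConst
  positivity

/-- The weight decays like `2^{-kr}` and the jump count grows like `2^{2k}`, which leaves a
geometric series of ratio `2^{2-r}`. -/
lemma tsum_jump_bound (d : ℕ) {r B : ℝ} (hr : 2 < r) (hB : 0 < B) :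
    ∑' k : ℕ, ENNReal.ofReal (2 * B * (1 / 2) ^ k) ^ r *
      ENNReal.ofReal ((1 + 8 * 2 ^ d) * (B / (B * (1 / 2) ^ (k + 1))) ^ 2) =
      ENNReal.ofReal (jumpConst d r * B ^ r) := by
  have hterm : ∀ k : ℕ, ENNReal.ofReal (2 * B * (1 / 2) ^ k) ^ r *
      ENNReal.ofReal ((1 + 8 * 2 ^ d) * (B / (B * (1 / 2) ^ (k + 1))) ^ 2) =
      ENNReal.ofReal (2 ^ r * (4 * (1 + 8 * 2 ^ d)) * B ^ r * (2 ^ (2 - r)) ^ k) := fun k => by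
    rw [ENNReal.ofReal_rpow_of_pos (by positivity), ← ENNReal.ofReal_mul (by positivity)]
    congr 1
    have e1 : B / (B * (1 / 2) ^ (k + 1)) = 2 * 2 ^ k := by
      rw [div_mul_eq_div_div, div_self hB.ne', one_div, one_div, inv_pow, inv_inv, pow_succ,
        mul_comm]
    have e2 : ((1 / 2 : ℝ) ^ k) ^ r = (2 ^ k) ^ (-r) := by
      rw [one_div, inv_pow, Real.inv_rpow (by positivity), Real.rpow_neg (by positivity)]
    have e3 : ((2 : ℝ) ^ (2 - r)) ^ k = (2 ^ k) ^ 2 * (2 ^ k) ^ (-r) := by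
      rw [← Real.rpow_natCast, ← Real.rpow_mul (by norm_num), ← Real.rpow_natCast 2 k,
        ← Real.rpow_natCast _ 2, ← Real.rpow_mul (by norm_num), ← Real.rpow_mul (by norm_num),
        ← Real.rpow_add (by norm_num)]
      congr 1
      push_cast
      ring
    rw [e1, Real.mul_rpow (by positivity) (by positivity), Real.mul_rpow (by positivity) hB.le, e2,
      e3]
    ring
  have h0 : (0 : ℝ) ≤ 2 ^ (2 - r) := by positivity
  simp only [hterm]
  rw [← ENNReal.ofReal_tsum_of_nonneg (fun k => by positivity)
    ((summable_geometric_of_lt_one h0 (two_rpow_sub_lt_one hr)).mul_left _), tsum_mul_left,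
    tsum_geometric_of_lt_one h0 (two_rpow_sub_lt_one hr), jumpConst]
  congr 1
  ring

lemma IsDyadicMartingale.setLIntegral_weightedJumpCount_le {d : ℕ} {f : ℤ → (Fin d → ℝ) → ℝ}
    (hf : IsDyadicMartingale f) {r B : ℝ} (hr : 2 < r) (hB : 0 < B) {n : ℤ}
    {G : Set (Fin d → ℝ)} (hG : ∀ y ∈ G, ControlledAt B (shiftSeq f n y))
    {k : Fin d → ℤ} (hGk : G ⊆ dyadicCube n k) (i : ℕ) :
    ∫⁻ x in cubeHull (n + i) G, weightedJumpCount r B (shiftSeq f n x) i ≤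
      ENNReal.ofReal (jumpConst d r * B ^ r) * volume (dyadicCube n k) := by
  have hmeas : ∀ μ : ℝ, Measurable fun x => ((greedyState μ (shiftSeq f n x) i).2 : ℝ≥0∞) :=
    fun μ => CubeConst.measurable (n := n + i) fun x y hxy => by
      have := hf.cubeConst_greedyState μ n i x y hxy
      simp only at this
      rw [this]
  simp only [weightedJumpCount]
  rw [lintegral_tsum fun j => ((hmeas _).const_mul _).aemeasurable, ← tsum_jump_bound d hr hB,
    ← ENNReal.tsum_mul_right]
  refine ENNReal.tsum_le_tsum fun j => ?_
  have hμ : 0 < B * (1 / 2) ^ (j + 1) := by positivity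
  rw [lintegral_const_mul _ (hmeas _), mul_assoc (_ ^ r)]
  exact mul_le_mul_right (hf.setLIntegral_greedyState_le hB hG hμ hGk i) _

/-- On a cube where the variation up to the previous generation is at most `lam`, the points with
large variation but small maximal and square functions have small Lebesgue measure. -/
lemma IsDyadicMartingale.volume_clampVariation_le {d : ℕ} {f : ℤ → (Fin d → ℝ) → ℝ}
    (hf : IsDyadicMartingale f) {r δ lam : ℝ} (hr : 2 < r) (hδ : 0 < δ) (hδ' : δ ≤ 1 / 2)
    (hlam : 0 < lam) {N n : ℤ} (hNn : N < n) {G : Set (Fin d → ℝ)}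
    (hG : ∀ y ∈ G, ControlledAt (δ * lam) (shiftSeq f n y))
    (hM : ∀ y ∈ G, ∀ m, |f m y| ≤ δ * lam)
    (hV : ∀ y ∈ G, clampVariation r f N (n - 1) y ≤ ENNReal.ofReal lam)
    {k : Fin d → ℤ} (hGk : G ⊆ dyadicCube n k) (i : ℕ) :
    volume (G ∩ {x | ENNReal.ofReal (3 * lam) < clampVariation r f N (n + i) x}) ≤
      ENNReal.ofReal (jumpConst d r * δ ^ r) * volume (dyadicCube n k) := by
  have hr0 : 0 < r := by linarith
  have hB : 0 < δ * lam := by positivity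
  set a := ENNReal.ofReal lam ^ r with ha
  have ha0 : a ≠ 0 := (ENNReal.rpow_pos (ENNReal.ofReal_pos.2 hlam) ENNReal.ofReal_ne_top).ne'
  have hat : a ≠ ∞ := ENNReal.rpow_ne_top_of_nonneg hr0.le ENNReal.ofReal_ne_top
  have hsub : G ∩ {x | ENNReal.ofReal (3 * lam) < clampVariation r f N (n + i) x} ⊆
      {x | a ≤ weightedJumpCount r (δ * lam) (shiftSeq f n x) i} ∩ cubeHull (n + i) G := by
    rintro x ⟨hxG, hx⟩
    refine ⟨?_, subset_cubeHull _ _ hxG⟩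
    have h := rpow_lt_of_lt_clampVariation hr0 hB (hM x hxG) hNn i (hV x hxG) hx
    by_contra hc
    refine absurd h (not_lt.2 ?_)
    -- If the jump count were below `a = λ^r`, all three parts would be at most `a`, the crossing
    -- one by `δ ≤ 1 / 2`; but `3 * a ≤ 3 ^ r * a`.
    calc _ ≤ a + a + a := by
          gcongr
          · exact (not_le.1 hc).le
          · exact ENNReal.rpow_le_rpow (ENNReal.ofReal_le_ofReal (by nlinarith)) hr0.le
      _ = 3 * a := by ring
      _ ≤ 3 ^ r * a := by
          gcongr
          conv_lhs => rw [← ENNReal.rpow_one 3]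
          exact ENNReal.rpow_le_rpow_of_exponent_le (by norm_num) (by linarith)
      _ = _ := by
          rw [ENNReal.ofReal_mul (by norm_num), ENNReal.mul_rpow_of_nonneg _ _ hr0.le,
            ENNReal.ofReal_ofNat]
  have hmeas : Measurable fun x => weightedJumpCount r (δ * lam) (shiftSeq f n x) i :=
    CubeConst.measurable (n := n + i) fun x y hxy => by
      have := fun μ => hf.cubeConst_greedyState μ n i x y hxy
      simp only at this
      simp only [weightedJumpCount, this]
  have h1 : a * volume (G ∩ {x | ENNReal.ofReal (3 * lam) < clampVariation r f N (n + i) x}) ≤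
      a * (ENNReal.ofReal (jumpConst d r * δ ^ r) * volume (dyadicCube n k)) := by
    calc _ ≤ a * volume.restrict (cubeHull (n + i) G)
          {x | a ≤ weightedJumpCount r (δ * lam) (shiftSeq f n x) i} := by
          refine mul_le_mul_right ?_ _
          rw [Measure.restrict_apply (measurableSet_le measurable_const hmeas)]
          exact measure_mono hsub
      _ ≤ _ := mul_meas_ge_le_lintegral hmeas a
      _ ≤ _ := hf.setLIntegral_weightedJumpCount_le hr hB hG hGk i
      _ = _ := by
          rw [← mul_assoc, ha, ENNReal.ofReal_rpow_of_pos hlam, ← ENNReal.ofReal_mul (by positivity),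
            Real.mul_rpow hδ.le hlam.le]
          congr 2
          ring
  exact (ENNReal.mul_le_mul_iff_right ha0 hat).1 h1

lemma abs_le_of_maximalFunction_lt {X : Type*} {f : ℤ → X → ℝ} {x : X} {B : ℝ} (hB : 0 ≤ B)
    (h : maximalFunction f x < ENNReal.ofReal B) (m : ℤ) : |f m x| ≤ B := by
  have : ‖f m x‖ₑ ≤ ENNReal.ofReal B := (le_iSup (fun m => ‖f m x‖ₑ) m).trans h.le
  rwa [← ofReal_norm, ENNReal.ofReal_le_ofReal_iff hB, Real.norm_eq_abs] at this

lemma sum_sq_le_of_squareFunction_le {d : ℕ} {f : ℤ → (Fin d → ℝ) → ℝ} {x : Fin d → ℝ} {B : ℝ}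
    (hB : 0 ≤ B) (h : squareFunction f x ≤ ENNReal.ofReal B) (n : ℤ) (i : ℕ) :
    ∑ j ∈ Finset.range i, (shiftSeq f n x (j + 1) - shiftSeq f n x j) ^ 2 ≤ B ^ 2 := by
  have h1 : ∑' m : ℤ, ‖f m x - f (m - 1) x‖ₑ ^ 2 ≤ ENNReal.ofReal B ^ 2 := by
    rw [squareFunction, one_div, ENNReal.rpow_inv_le_iff (by norm_num)] at h
    exact_mod_cast h
  rw [← ENNReal.ofReal_le_ofReal_iff (by positivity), ENNReal.ofReal_pow hB]
  refine le_trans ?_ h1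
  rw [ENNReal.ofReal_sum_of_nonneg fun _ _ => sq_nonneg _]
  -- The shift by one matches the backward differences in `squareFunction`.
  let e : ℕ ↪ ℤ := ⟨fun j => n + j + 1, fun a b hab => by simpa using hab⟩
  calc _ = ∑ m ∈ (Finset.range i).map e, ‖f m x - f (m - 1) x‖ₑ ^ 2 := by
        rw [Finset.sum_map]
        refine Finset.sum_congr rfl fun j _ => ?_
        rw [← sq_abs, ENNReal.ofReal_pow (abs_nonneg _), ← Real.norm_eq_abs, ofReal_norm]
        have he : e j - 1 = n + j := add_sub_cancel_right _ _
        rw [he, shiftSeq, Nat.cast_succ, ← add_assoc]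
        rfl
    _ ≤ _ := ENNReal.sum_le_tsum _

/-- The good-`λ` inequality on one dyadic cube, for the variation over the times from the
generation of that cube on. -/
lemma IsDyadicAInfty.good_lambda_cube {d : ℕ} {w : (Fin d → ℝ) → ℝ} (hw : IsDyadicAInfty w)
    {ε r : ℝ} (hε : 0 < ε) (hr : 2 < r) : ∃ δ : ℝ, 0 < δ ∧
      ∀ f : ℤ → (Fin d → ℝ) → ℝ, IsDyadicMartingale f → ∀ lam : ℝ, 0 < lam →
        ∀ (N : ℤ) (k : Fin d → ℤ),
        weightMeasure w ({x | ENNReal.ofReal (3 * lam) < tailVariation r f N x ∧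
            maximalFunction f x < ENNReal.ofReal (δ * lam)} ∩ dyadicCube N k) ≤
          weightMeasure w ({x | ENNReal.ofReal (δ * lam) < squareFunction f x} ∩ dyadicCube N k) +
          ENNReal.ofReal ε *
            weightMeasure w ({x | ENNReal.ofReal lam < tailVariation r f N x} ∩
              dyadicCube N k) := by
  obtain ⟨γ, hγ, hsmall⟩ := hw.small_of_small ε hε
  have hr0 : 0 < r := by linarith
  have hK := jumpConst_pos d hr
  -- Chosen so that `jumpConst d r * δ ^ r ≤ γ`, the threshold in the `A_∞` condition for `ε`.
  refine ⟨min (1 / 2) ((γ / jumpConst d r) ^ (1 / r)), by positivity, ?_⟩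
  set δ := min (1 / 2) ((γ / jumpConst d r) ^ (1 / r)) with hδdef
  have hδ : 0 < δ := by positivity
  have hδγ : jumpConst d r * δ ^ r ≤ γ := by
    have : δ ^ r ≤ γ / jumpConst d r := by
      calc δ ^ r ≤ ((γ / jumpConst d r) ^ (1 / r)) ^ r :=
            Real.rpow_le_rpow hδ.le (min_le_right _ _) hr0.le
        _ = _ := by
            rw [← Real.rpow_mul (by positivity), one_div_mul_cancel hr0.ne', Real.rpow_one]
    rw [le_div_iff₀ hK] at this
    linarith
  intro f hf lam hlam N k
  have hB : 0 ≤ δ * lam := by positivity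
  have hfm := hf.measurable
  set Q := dyadicCube N k with hQ
  have hQm : MeasurableSet Q := measurableSet_dyadicCube N k
  set H := {x | ENNReal.ofReal (3 * lam) < tailVariation r f N x ∧
    maximalFunction f x < ENNReal.ofReal (δ * lam) ∧
    squareFunction f x ≤ ENNReal.ofReal (δ * lam)} ∩ Q with hH
  have hHm : MeasurableSet H :=
    ((measurableSet_lt measurable_const (measurable_tailVariation r hfm N)).inter
      ((measurableSet_lt (measurable_maximalFunction hfm) measurable_const).inter
        (measurableSet_le (measurable_squareFunction hfm) measurable_const))).inter hQm
  set T := {x | ENNReal.ofReal lam < tailVariation r f N x} ∩ Q with hT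
  have hTm : MeasurableSet T :=
    (measurableSet_lt measurable_const (measurable_tailVariation r hfm N)).inter hQm
  suffices hmain : weightMeasure w H ≤ ENNReal.ofReal ε * weightMeasure w T by
    refine le_trans (measure_mono ?_) ((measure_union_le _ H).trans (add_le_add_right hmain _))
    rintro x ⟨⟨hx1, hx2⟩, hxQ⟩
    rcases lt_or_ge (ENNReal.ofReal (δ * lam)) (squareFunction f x) with h | h
    · exact Or.inl ⟨h, hxQ⟩
    · exact Or.inr ⟨⟨hx1, hx2, h⟩, hxQ⟩
  -- The level `lam` is first passed at generation `N + i + 1`; it cannot be at `N`, where there is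
  -- no increment yet.
  let E : ℕ → Set (Fin d → ℝ) := fun i =>
    {x | ENNReal.ofReal lam < clampVariation r f N (N + i + 1) x ∧
      clampVariation r f N (N + i) x ≤ ENNReal.ofReal lam}
  have hcc : ∀ i : ℕ, CubeConst (N + i) (clampVariation r f N (N + i)) := fun i =>
    hf.cubeConst_clampVariation r (by omega)
  have hcc' : ∀ i : ℕ, CubeConst (N + i + 1) (clampVariation r f N (N + i + 1)) := fun i =>
    hf.cubeConst_clampVariation r (by omega)
  have hEm : ∀ i, MeasurableSet (E i) := fun i =>
    (measurableSet_lt measurable_const (hcc' i).measurable).inter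
      (measurableSet_le (hcc i).measurable measurable_const)
  have hEdisj : ∀ i j, i < j → Disjoint (E i) (E j) := fun i j hij =>
    Set.disjoint_left.2 fun x hi hj => absurd (hi.1.trans_le
      (clampVariation_mono hr0 f N x (show N + i + 1 ≤ N + j by omega))) (not_lt.2 hj.2)
  have hcover : H ⊆ ⋃ i, H ∩ E i := fun x hx => by
    have h1 : ENNReal.ofReal lam < tailVariation r f N x :=
      lt_of_le_of_lt (ENNReal.ofReal_le_ofReal (by linarith)) hx.1.1
    obtain ⟨n, hn, hlt⟩ := (lt_tailVariation_iff hr0 f N x _).1 h1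
    have hex : ∃ i : ℕ, ENNReal.ofReal lam < clampVariation r f N (N + i) x :=
      ⟨(n - N).toNat, by rwa [Int.toNat_of_nonneg (by omega), add_sub_cancel]⟩
    classical
    obtain ⟨j, hj⟩ : ∃ j, Nat.find hex = j + 1 := by
      refine Nat.exists_eq_succ_of_ne_zero fun h0 => ?_
      have := Nat.find_spec hex
      rw [h0, Nat.cast_zero, add_zero, clampVariation_self hr0] at this
      exact not_lt_zero this
    refine Set.mem_iUnion.2 ⟨j, hx, ?_, not_lt.1 (Nat.find_min hex (m := j) (by omega))⟩
    have := Nat.find_spec hex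
    rw [hj] at this
    simpa only [Nat.cast_succ, ← add_assoc] using this
  have hstep : ∀ i, weightMeasure w (H ∩ E i) ≤
      ENNReal.ofReal ε * weightMeasure w (T ∩ E i) := fun i => by
    refine (measure_le_tsum_inter_dyadicCube _ (N + i + 1) _).trans ?_
    rw [← tsum_measure_inter_dyadicCube _ (N + i + 1) (hTm.inter (hEm i)), ← ENNReal.tsum_mul_left]
    refine ENNReal.tsum_le_tsum fun k' => ?_
    set I := dyadicCube (N + i + 1) k' with hI
    rcases (H ∩ E i ∩ I).eq_empty_or_nonempty with he | ⟨x₀, ⟨hx₀H, hx₀E⟩, hx₀I⟩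
    · simp [he]
    -- First passage is decided at the generation of `I`, so one point of `E i` in `I` puts all of
    -- `I` there.
    have hIT : I ⊆ T ∩ E i := fun y hy => by
      have hidx : dyadicIndex (N + i + 1) y = dyadicIndex (N + i + 1) x₀ :=
        (mem_dyadicCube_iff.1 hy).trans (mem_dyadicCube_iff.1 hx₀I).symm
      have hyE : y ∈ E i := by
        refine ⟨?_, ?_⟩
        · rw [hcc' i y x₀ hidx]; exact hx₀E.1
        · rw [(hcc i).mono (by omega) y x₀ hidx]; exact hx₀E.2
      refine ⟨⟨hyE.1.trans_le (clampVariation_le_tailVariation hr0 f N _ y), ?_⟩, hyE⟩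
      exact mem_dyadicCube_iff.2 ((dyadicIndex_eq_of_le (by omega) hidx).trans
        (mem_dyadicCube_iff.1 hx₀H.2))
    rw [Set.inter_eq_right.2 hIT]
    refine hsmall (N + i + 1) k' _ ((hHm.inter (hEm i)).inter (measurableSet_dyadicCube _ _))
      Set.inter_subset_right ?_
    refine le_trans ?_ (mul_le_mul_left (ENNReal.ofReal_le_ofReal hδγ) _)
    set G := H ∩ E i ∩ I with hG
    have hGM : ∀ y ∈ G, ∀ m, |f m y| ≤ δ * lam := fun y hy m =>
      abs_le_of_maximalFunction_lt hB hy.1.1.1.2.1 m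
    -- The excess over `3 * lam` appears at a finite time, and the bound for each time is uniform.
    have hGsub : G ⊆ ⋃ j : ℕ, G ∩
        {x | ENNReal.ofReal (3 * lam) < clampVariation r f N (N + i + 1 + j) x} := fun y hy => by
      obtain ⟨n, -, hlt⟩ := (lt_tailVariation_iff hr0 f N y _).1 hy.1.1.1.1
      refine Set.mem_iUnion.2 ⟨(n - (N + i + 1)).toNat, hy, hlt.trans_le ?_⟩
      exact clampVariation_mono hr0 f N y (by omega)
    refine (measure_mono hGsub).trans ?_
    rw [Monotone.measure_iUnion]
    · refine iSup_le fun j => hf.volume_clampVariation_le hr hδ (min_le_left _ _) hlam (by omega)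
        (fun y hy => ⟨fun j => hGM y hy _, ?_⟩) hGM (fun y hy => ?_) Set.inter_subset_right j
      · exact sum_sq_le_of_squareFunction_le hB hy.1.1.1.2.2 _
      · rw [add_sub_cancel_right]
        exact hy.1.2.2
    · refine fun a b hab => Set.inter_subset_inter_right _ fun y hy => ?_
      exact lt_of_lt_of_le hy (clampVariation_mono hr0 f N y (by omega))
  calc weightMeasure w H ≤ weightMeasure w (⋃ i, H ∩ E i) := measure_mono hcover
    _ ≤ ∑' i, weightMeasure w (H ∩ E i) := measure_iUnion_le _
    _ ≤ ∑' i, ENNReal.ofReal ε * weightMeasure w (T ∩ E i) := ENNReal.tsum_le_tsum hstep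
    _ = ENNReal.ofReal ε * weightMeasure w (⋃ i, T ∩ E i) := by
        rw [ENNReal.tsum_mul_left, measure_iUnion]
        · intro i j hij
          refine Disjoint.mono Set.inter_subset_right Set.inter_subset_right ?_
          rcases lt_or_gt_of_ne hij with h | h
          · exact hEdisj i j h
          · exact (hEdisj j i h).symm
        · exact fun i => hTm.inter (hEm i)
    _ ≤ ENNReal.ofReal ε * weightMeasure w T := by
        gcongr
        exact Set.iUnion_subset fun i => Set.inter_subset_left

/-! ### From the good-`λ` inequality to norms -/

section LayerCake

variable {α : Type*} [MeasurableSpace α] {μ : Measure α}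

lemma lintegral_rpow_eq_lintegral_ofReal_toReal {F : α → ℝ≥0∞} (hfin : ∀ᵐ x ∂μ, F x ≠ ∞) {p : ℝ}
    (hp : 0 ≤ p) : ∫⁻ x, F x ^ p ∂μ = ∫⁻ x, ENNReal.ofReal ((F x).toReal ^ p) ∂μ := by
  refine lintegral_congr_ae (hfin.mono fun x hx => ?_)
  simp only
  rw [← ENNReal.ofReal_rpow_of_nonneg ENNReal.toReal_nonneg hp, ENNReal.ofReal_toReal hx]

lemma lintegral_rpow_eq_lintegral_meas_ofReal_lt {F : α → ℝ≥0∞} (hF : Measurable F)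
    (hfin : ∀ᵐ x ∂μ, F x ≠ ∞) {p : ℝ} (hp : 0 < p) :
    ∫⁻ x, F x ^ p ∂μ = ENNReal.ofReal p *
      ∫⁻ t in Set.Ioi (0 : ℝ), μ {x | ENNReal.ofReal t < F x} * ENNReal.ofReal (t ^ (p - 1)) := by
  have h := lintegral_rpow_eq_lintegral_meas_lt_mul μ (f := fun x => (F x).toReal)
    (Filter.Eventually.of_forall fun x => ENNReal.toReal_nonneg) hF.ennreal_toReal.aemeasurable hp
  rw [lintegral_rpow_eq_lintegral_ofReal_toReal hfin hp.le, h]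
  congr 1
  refine setLIntegral_congr_fun measurableSet_Ioi fun t ht => ?_
  congr 1
  refine measure_congr (hfin.mono fun x hx => ?_)
  exact propext (ENNReal.ofReal_lt_iff_lt_toReal (le_of_lt ht) hx).symm

lemma lintegral_rpow_eq_lintegral_meas_ofReal_le {F : α → ℝ≥0∞} (hF : Measurable F)
    (hfin : ∀ᵐ x ∂μ, F x ≠ ∞) {p : ℝ} (hp : 0 < p) :
    ∫⁻ x, F x ^ p ∂μ = ENNReal.ofReal p *
      ∫⁻ t in Set.Ioi (0 : ℝ), μ {x | ENNReal.ofReal t ≤ F x} * ENNReal.ofReal (t ^ (p - 1)) := by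
  have h := lintegral_rpow_eq_lintegral_meas_le_mul μ (f := fun x => (F x).toReal)
    (Filter.Eventually.of_forall fun x => ENNReal.toReal_nonneg) hF.ennreal_toReal.aemeasurable hp
  rw [lintegral_rpow_eq_lintegral_ofReal_toReal hfin hp.le, h]
  congr 1
  refine setLIntegral_congr_fun measurableSet_Ioi fun t ht => ?_
  congr 1
  refine measure_congr (hfin.mono fun x hx => ?_)
  exact propext (ENNReal.ofReal_le_iff_le_toReal hx).symm

lemma measurable_meas_ofReal_lt_mul (F : α → ℝ≥0∞) (p : ℝ) :
    Measurable fun t : ℝ => μ {x | ENNReal.ofReal t < F x} * ENNReal.ofReal (t ^ (p - 1)) := by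
  refine Measurable.mul (Antitone.measurable fun s t hst => measure_mono fun x hx => ?_) (by fun_prop)
  exact lt_of_le_of_lt (ENNReal.ofReal_le_ofReal hst) hx

lemma lintegral_rpow_iSup {g : ℕ → α → ℝ≥0∞} (hg : ∀ i, Measurable (g i)) (hm : Monotone g)
    {p : ℝ} (hp : 0 < p) : ∫⁻ x, (⨆ i, g i x) ^ p ∂μ = ⨆ i, ∫⁻ x, g i x ^ p ∂μ := by
  rw [← lintegral_iSup (fun i => (hg i).pow_const p)
    fun i j hij x => ENNReal.rpow_le_rpow (hm hij x) hp.le]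
  exact lintegral_congr fun x => (ENNReal.orderIsoRpow p hp).map_iSup _

lemma ae_ne_top_of_lintegral_rpow_ne_top {F : α → ℝ≥0∞} (hF : Measurable F) {p : ℝ} (hp : 0 < p)
    (h : ∫⁻ x, F x ^ p ∂μ ≠ ∞) : ∀ᵐ x ∂μ, F x ≠ ∞ :=
  (ae_lt_top (hF.pow_const p) h).mono fun x hx h' => by simp [h', hp] at hx

/-- A good-`λ` inequality on a finite measure space gives a bound for `p`-th moments. -/
lemma lintegral_rpow_le_of_good_lambda [IsFiniteMeasure μ] {X Y Z : α → ℝ≥0∞}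
    (hX : Measurable X) (hY : Measurable Y) (hZ : Measurable Z) {p δ : ℝ} (hp : 0 < p)
    (hδ : 0 < δ)
    (h : ∀ t : ℝ, 0 < t → μ {x | ENNReal.ofReal (3 * t) < X x ∧ Z x < ENNReal.ofReal (δ * t)} ≤
      μ {x | ENNReal.ofReal (δ * t) < Y x} +
        ENNReal.ofReal ((3 ^ p)⁻¹ / 2) * μ {x | ENNReal.ofReal t < X x}) :
    ∫⁻ x, X x ^ p ∂μ ≤ ENNReal.ofReal (2 * (3 / δ) ^ p) *
      (∫⁻ x, Y x ^ p ∂μ + ∫⁻ x, Z x ^ p ∂μ) := by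
  have hδ0 : ENNReal.ofReal δ ≠ 0 := (ENNReal.ofReal_pos.2 hδ).ne'
  have hCpos : 0 < 2 * (3 / δ) ^ p := by positivity
  by_cases hYt : ∫⁻ x, Y x ^ p ∂μ = ∞
  · rw [hYt, top_add, ENNReal.mul_top (ENNReal.ofReal_pos.2 hCpos).ne']
    exact le_top
  by_cases hZt : ∫⁻ x, Z x ^ p ∂μ = ∞
  · rw [hZt, add_top, ENNReal.mul_top (ENNReal.ofReal_pos.2 hCpos).ne']
    exact le_top
  have hYfin := ae_ne_top_of_lintegral_rpow_ne_top hY hp hYt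
  have hZfin := ae_ne_top_of_lintegral_rpow_ne_top hZ hp hZt
  -- On a finite measure space the truncated moment is finite, hence can be absorbed.
  suffices hL : ∀ L : ℕ, ∫⁻ x, (min (X x) L) ^ p ∂μ ≤ ENNReal.ofReal (2 * (3 / δ) ^ p) *
      (∫⁻ x, Y x ^ p ∂μ + ∫⁻ x, Z x ^ p ∂μ) by
    have hsup : ∀ x, X x = ⨆ L : ℕ, min (X x) (L : ℝ≥0∞) := fun x => by
      rw [← inf_iSup_eq, ENNReal.iSup_natCast, inf_top_eq]
    calc ∫⁻ x, X x ^ p ∂μ = ∫⁻ x, (⨆ L : ℕ, min (X x) (L : ℝ≥0∞)) ^ p ∂μ :=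
          lintegral_congr fun x => by rw [← hsup x]
      _ = ⨆ L : ℕ, ∫⁻ x, (min (X x) (L : ℝ≥0∞)) ^ p ∂μ :=
          lintegral_rpow_iSup (fun L => hX.min measurable_const)
            (fun a b hab x => min_le_min_left _ (Nat.cast_le.2 hab)) hp
      _ ≤ _ := iSup_le hL
  intro L
  set V : α → ℝ≥0∞ := fun x => min (X x) L with hV
  have hVm : Measurable V := hX.min measurable_const
  have hVt : ∀ x, V x ≠ ∞ := fun x =>
    ((min_le_right _ _).trans_lt (ENNReal.natCast_lt_top L)).ne
  have hVint : ∫⁻ x, V x ^ p ∂μ ≠ ∞ := by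
    refine ne_top_of_le_ne_top (b := (L : ℝ≥0∞) ^ p * μ Set.univ) ?_ ?_
    · exact ENNReal.mul_ne_top (ENNReal.rpow_ne_top_of_nonneg hp.le (ENNReal.natCast_ne_top L))
        (measure_ne_top μ _)
    · rw [← lintegral_const]
      exact lintegral_mono fun x => ENNReal.rpow_le_rpow (min_le_right _ _) hp.le
  have hgood : ∀ t : ℝ, 0 < t → μ {x | ENNReal.ofReal t < V x / 3} ≤
      μ {x | ENNReal.ofReal t ≤ Z x / ENNReal.ofReal δ} +
      (μ {x | ENNReal.ofReal t < Y x / ENNReal.ofReal δ} +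
        ENNReal.ofReal ((3 ^ p)⁻¹ / 2) * μ {x | ENNReal.ofReal t < V x}) := fun t ht => by
    have e1 : ∀ x, ENNReal.ofReal t < V x / 3 ↔
        ENNReal.ofReal (3 * t) < X x ∧ ENNReal.ofReal (3 * t) < L := fun x => by
      rw [ENNReal.lt_div_iff_mul_lt (Or.inl (by norm_num)) (Or.inl (by norm_num)), mul_comm 3 t,
        ENNReal.ofReal_mul ht.le, ENNReal.ofReal_ofNat, hV, lt_min_iff]
    have e2 : ∀ x, ENNReal.ofReal t ≤ Z x / ENNReal.ofReal δ ↔ ENNReal.ofReal (δ * t) ≤ Z x :=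
      fun x => by
        rw [ENNReal.le_div_iff_mul_le (Or.inl hδ0) (Or.inl ENNReal.ofReal_ne_top), mul_comm,
          ENNReal.ofReal_mul hδ.le]
    have e3 : ∀ x, ENNReal.ofReal t < Y x / ENNReal.ofReal δ ↔ ENNReal.ofReal (δ * t) < Y x :=
      fun x => by
        rw [ENNReal.lt_div_iff_mul_lt (Or.inl hδ0) (Or.inl ENNReal.ofReal_ne_top), mul_comm,
          ENNReal.ofReal_mul hδ.le]
    simp only [e1, e2, e3]
    -- Truncation keeps the good-`λ` inequality: below `L` the level sets of `V` and `X` agree,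
    -- otherwise the left side is empty.
    by_cases hLt : ENNReal.ofReal (3 * t) < L
    · have e4 : ∀ x, ENNReal.ofReal t < V x ↔ ENNReal.ofReal t < X x := fun x => by
        rw [hV, lt_min_iff]
        exact and_iff_left (lt_of_le_of_lt (ENNReal.ofReal_le_ofReal (by linarith)) hLt)
      simp only [e4, hLt, and_true]
      refine le_trans (le_trans (measure_mono fun x hx => ?_) (measure_union_le _ _))
        (add_le_add_right (h t ht) _)
      rcases lt_or_ge (Z x) (ENNReal.ofReal (δ * t)) with hz | hz
      · exact Or.inr ⟨hx, hz⟩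
      · exact Or.inl hz
    · simp only [hLt, and_false, Set.ofPred_false, measure_empty, zero_le]
  have hdiv : ∀ {F : α → ℝ≥0∞} {a : ℝ≥0∞}, (∀ᵐ x ∂μ, F x ≠ ∞) → a ≠ 0 →
      ∀ᵐ x ∂μ, F x / a ≠ ∞ := fun hF ha => hF.mono fun x hx => ENNReal.div_ne_top hx ha
  have hVae : ∀ᵐ x ∂μ, V x ≠ ∞ := Filter.Eventually.of_forall hVt
  have hmom : ∫⁻ x, (V x / 3) ^ p ∂μ ≤ ∫⁻ x, (Z x / ENNReal.ofReal δ) ^ p ∂μ +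
      (∫⁻ x, (Y x / ENNReal.ofReal δ) ^ p ∂μ +
        ENNReal.ofReal ((3 ^ p)⁻¹ / 2) * ∫⁻ x, V x ^ p ∂μ) := by
    rw [lintegral_rpow_eq_lintegral_meas_ofReal_lt (hVm.div_const _) (hdiv hVae (by norm_num)) hp,
      lintegral_rpow_eq_lintegral_meas_ofReal_le (hZ.div_const _) (hdiv hZfin hδ0) hp,
      lintegral_rpow_eq_lintegral_meas_ofReal_lt (hY.div_const _) (hdiv hYfin hδ0) hp,
      lintegral_rpow_eq_lintegral_meas_ofReal_lt hVm hVae hp, mul_left_comm, ← mul_add, ← mul_add,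
      ← lintegral_const_mul' (ENNReal.ofReal ((3 ^ p)⁻¹ / 2)) _ ENNReal.ofReal_ne_top,
      ← lintegral_add_left (measurable_meas_ofReal_lt_mul _ p),
      ← lintegral_add_right]
    swap
    · exact (measurable_meas_ofReal_lt_mul _ p).add
        ((measurable_meas_ofReal_lt_mul _ p).const_mul _)
    refine mul_le_mul_right (setLIntegral_mono' measurableSet_Ioi fun t ht => ?_) _
    refine (mul_le_mul_left (hgood t ht) _).trans (le_of_eq ?_)
    ring
  have hscale : ∀ (F : α → ℝ≥0∞) (a : ℝ), 0 < a → ∫⁻ x, (F x / ENNReal.ofReal a) ^ p ∂μ =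
      ENNReal.ofReal ((a ^ p)⁻¹) * ∫⁻ x, F x ^ p ∂μ := fun F a ha => by
    rw [← lintegral_const_mul' _ _ ENNReal.ofReal_ne_top]
    refine lintegral_congr fun x => ?_
    rw [div_eq_mul_inv, ENNReal.mul_rpow_of_nonneg _ _ hp.le, ← ENNReal.ofReal_inv_of_pos ha,
      ENNReal.ofReal_rpow_of_pos (by positivity), Real.inv_rpow ha.le, mul_comm]
  have h3 := hscale V 3 (by norm_num)
  rw [ENNReal.ofReal_ofNat] at h3
  rw [h3, hscale Z δ hδ, hscale Y δ hδ] at hmom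
  set v := ∫⁻ x, V x ^ p ∂μ
  set y := ∫⁻ x, Y x ^ p ∂μ
  set z := ∫⁻ x, Z x ^ p ∂μ
  rw [← ENNReal.ofReal_toReal hVint, ← ENNReal.ofReal_toReal hYt, ← ENNReal.ofReal_toReal hZt]
    at hmom ⊢
  have hv := ENNReal.toReal_nonneg (a := v)
  have hy := ENNReal.toReal_nonneg (a := y)
  have hz := ENNReal.toReal_nonneg (a := z)
  rw [← ENNReal.ofReal_mul (by positivity), ← ENNReal.ofReal_mul (by positivity),
    ← ENNReal.ofReal_mul (by positivity), ← ENNReal.ofReal_mul (by positivity),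
    ← ENNReal.ofReal_add (by positivity) (by positivity),
    ← ENNReal.ofReal_add (by positivity) (by positivity),
    ENNReal.ofReal_le_ofReal_iff (by positivity)] at hmom
  rw [← ENNReal.ofReal_add hy hz, ← ENNReal.ofReal_mul hCpos.le]
  refine ENNReal.ofReal_le_ofReal ?_
  have h3p : (0 : ℝ) < 3 ^ p := by positivity
  rw [Real.div_rpow (by norm_num) hδ.le]
  -- With the factor `(3 ^ p)⁻¹ / 2` in the hypothesis, half of the left side is absorbed.
  have key : (3 ^ p)⁻¹ / 2 * v.toReal ≤ (δ ^ p)⁻¹ * (y.toReal + z.toReal) := by linarith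
  calc v.toReal = 2 * 3 ^ p * ((3 ^ p)⁻¹ / 2 * v.toReal) := by field_simp
    _ ≤ 2 * 3 ^ p * ((δ ^ p)⁻¹ * (y.toReal + z.toReal)) := by gcongr
    _ = _ := by ring

end LayerCake

/-! ### Summation over cubes and conclusion -/

lemma IsDyadicAInfty.weightMeasure_dyadicCube_lt_top {d : ℕ} {w : (Fin d → ℝ) → ℝ}
    (hw : IsDyadicAInfty w) (n : ℤ) (k : Fin d → ℤ) : weightMeasure w (dyadicCube n k) < ∞ := by
  rw [weightMeasure, withDensity_apply _ (measurableSet_dyadicCube n k)]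
  exact (integrableOn_dyadicCube hw.locallyIntegrable n k).lintegral_lt_top

lemma IsDyadicAInfty.good_lambda {d : ℕ} {w : (Fin d → ℝ) → ℝ} (hw : IsDyadicAInfty w)
    {ε r : ℝ} (hε : 0 < ε) (hr : 2 < r) : ∃ δ : ℝ, 0 < δ ∧
      ∀ f : ℤ → (Fin d → ℝ) → ℝ, IsDyadicMartingale f → ∀ lam : ℝ, 0 < lam →
        weightMeasure w {x | ENNReal.ofReal (3 * lam) < rVariation r f x ∧
            maximalFunction f x < ENNReal.ofReal (δ * lam)} ≤
          weightMeasure w {x | ENNReal.ofReal (δ * lam) < squareFunction f x} +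
          ENNReal.ofReal ε * weightMeasure w {x | ENNReal.ofReal lam < rVariation r f x} := by
  obtain ⟨δ, hδ, h⟩ := hw.good_lambda_cube hε hr
  have hr0 : 0 < r := by linarith
  refine ⟨δ, hδ, fun f hf lam hlam => ?_⟩
  have hsub : {x | ENNReal.ofReal (3 * lam) < rVariation r f x ∧
      maximalFunction f x < ENNReal.ofReal (δ * lam)} ⊆
      ⋃ i : ℕ, {x | ENNReal.ofReal (3 * lam) < tailVariation r f (-(i : ℤ)) x ∧
        maximalFunction f x < ENNReal.ofReal (δ * lam)} := fun x hx => by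
    obtain ⟨i, hi⟩ := (lt_rVariation_iff_tail hr0 f x _).1 hx.1
    exact Set.mem_iUnion.2 ⟨i, hi, hx.2⟩
  refine (measure_mono hsub).trans ?_
  rw [Monotone.measure_iUnion]
  swap
  · exact fun i j hij x hx => ⟨hx.1.trans_le (tailVariation_anti hr0 f x (by omega)), hx.2⟩
  refine iSup_le fun i => ?_
  calc _ ≤ _ := measure_le_tsum_inter_dyadicCube _ (-(i : ℤ)) _
    _ ≤ _ := ENNReal.tsum_le_tsum fun k => h f hf lam hlam (-(i : ℤ)) k
    _ = _ := by
        rw [ENNReal.tsum_add, ENNReal.tsum_mul_left, tsum_measure_inter_dyadicCube,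
          tsum_measure_inter_dyadicCube]
        · exact measurableSet_lt measurable_const (measurable_tailVariation r hf.measurable _)
        · exact measurableSet_lt measurable_const (measurable_squareFunction hf.measurable)
    _ ≤ _ := by
        gcongr
        exact tailVariation_le hr0 f _ _

/-- The moment bound is applied on each cube because `w` need not have finite total mass; its
constant does not depend on the cube or the starting time. -/
lemma IsDyadicAInfty.lintegral_rVariation_rpow_le {d : ℕ} {w : (Fin d → ℝ) → ℝ}
    (hw : IsDyadicAInfty w) {p r : ℝ} (hp : 0 < p) (hr : 2 < r) : ∃ a : ℝ, 0 < a ∧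
      ∀ f : ℤ → (Fin d → ℝ) → ℝ, IsDyadicMartingale f →
        ∫⁻ x, rVariation r f x ^ p ∂weightMeasure w ≤ ENNReal.ofReal a *
          (∫⁻ x, squareFunction f x ^ p ∂weightMeasure w +
            ∫⁻ x, maximalFunction f x ^ p ∂weightMeasure w) := by
  obtain ⟨δ, hδ, h⟩ := hw.good_lambda_cube (ε := (3 ^ p)⁻¹ / 2) (by positivity) hr
  have hr0 : 0 < r := by linarith
  refine ⟨2 * (3 / δ) ^ p, by positivity, fun f hf => ?_⟩
  have hfm := hf.measurable
  simp only [rVariation_eq_iSup_tail hr0]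
  rw [lintegral_rpow_iSup (fun i => measurable_tailVariation r hfm _)
    (fun i j hij x => tailVariation_anti hr0 f x (by omega)) hp]
  refine iSup_le fun i => ?_
  have hsplit : ∀ g : (Fin d → ℝ) → ℝ≥0∞, ∫⁻ x, g x ∂weightMeasure w =
      ∑' k, ∫⁻ x in dyadicCube (-(i : ℤ)) k, g x ∂weightMeasure w := fun g => by
    have := setLIntegral_eq_tsum_dyadicCube (weightMeasure w) (-(i : ℤ)) MeasurableSet.univ g
    simpa only [Measure.restrict_univ, Set.univ_inter] using this
  rw [hsplit, hsplit fun x => squareFunction f x ^ p, hsplit fun x => maximalFunction f x ^ p,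
    ← ENNReal.tsum_add, ← ENNReal.tsum_mul_left]
  refine ENNReal.tsum_le_tsum fun k => ?_
  have : IsFiniteMeasure ((weightMeasure w).restrict (dyadicCube (-(i : ℤ)) k)) :=
    ⟨by rw [Measure.restrict_apply_univ]; exact hw.weightMeasure_dyadicCube_lt_top _ _⟩
  refine lintegral_rpow_le_of_good_lambda (measurable_tailVariation r hfm _)
    (measurable_squareFunction hfm) (measurable_maximalFunction hfm) hp hδ fun t ht => ?_
  simp only [Measure.restrict_apply' (measurableSet_dyadicCube (-(i : ℤ)) k)]
  exact h f hf t ht (-(i : ℤ)) k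

theorem mainTheorem2 {d : ℕ} (w : (Fin d → ℝ) → ℝ) (hw : IsDyadicAInfty w) :
    (∃ C : ℝ, 0 < C ∧ ∀ ε r : ℝ, 0 < ε → 2 < r → ∃ δ : ℝ, 0 < δ ∧
      ∀ f : ℤ → (Fin d → ℝ) → ℝ, IsDyadicMartingale f → ∀ lam : ℝ, 0 < lam →
        weightMeasure w {x | ENNReal.ofReal (3 * lam) < rVariation r f x ∧
            maximalFunction f x < ENNReal.ofReal (δ * lam)} ≤
          ENNReal.ofReal C * weightMeasure w {x | ENNReal.ofReal (δ * lam) < squareFunction f x} +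
          ENNReal.ofReal ε * weightMeasure w {x | ENNReal.ofReal lam < rVariation r f x}) ∧
    (∀ p r : ℝ, 1 ≤ p → 2 < r → ∃ c : ℝ, 0 < c ∧
      ∀ f : ℤ → (Fin d → ℝ) → ℝ, IsDyadicMartingale f →
        ENNReal.ofReal c * eLpNorm (rVariation r f) (ENNReal.ofReal p) (weightMeasure w) ≤
          eLpNorm (squareFunction f) (ENNReal.ofReal p) (weightMeasure w) +
          eLpNorm (maximalFunction f) (ENNReal.ofReal p) (weightMeasure w)) := by
  refine ⟨⟨1, one_pos, fun ε r hε hr => ?_⟩, fun p r hp hr => ?_⟩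
  · obtain ⟨δ, hδ, h⟩ := hw.good_lambda hε hr
    refine ⟨δ, hδ, fun f hf lam hlam => ?_⟩
    rw [ENNReal.ofReal_one, one_mul]
    exact h f hf lam hlam
  · have hp0 : 0 < p := by linarith
    obtain ⟨a, ha, h⟩ := hw.lintegral_rVariation_rpow_le hp0 hr
    refine ⟨(a ^ (1 / p))⁻¹, by positivity, fun f hf => ?_⟩
    have hnorm : ∀ g : (Fin d → ℝ) → ℝ≥0∞, eLpNorm g (ENNReal.ofReal p) (weightMeasure w) =
        (∫⁻ x, g x ^ p ∂weightMeasure w) ^ (1 / p) := fun g => by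
      rw [eLpNorm_eq_lintegral_rpow_enorm_toReal (ENNReal.ofReal_pos.2 hp0).ne'
        ENNReal.ofReal_ne_top, ENNReal.toReal_ofReal hp0.le]
      simp only [enorm_eq_self]
    have hp1 : 0 ≤ 1 / p := by positivity
    simp only [hnorm]
    calc _ ≤ ENNReal.ofReal (a ^ (1 / p))⁻¹ * (ENNReal.ofReal a *
          (∫⁻ x, squareFunction f x ^ p ∂weightMeasure w +
            ∫⁻ x, maximalFunction f x ^ p ∂weightMeasure w)) ^ (1 / p) := by
          gcongr
          exact h f hf
      _ = (∫⁻ x, squareFunction f x ^ p ∂weightMeasure w +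
            ∫⁻ x, maximalFunction f x ^ p ∂weightMeasure w) ^ (1 / p) := by
          rw [ENNReal.mul_rpow_of_nonneg _ _ hp1, ENNReal.ofReal_rpow_of_pos ha, ← mul_assoc,
            ← ENNReal.ofReal_mul (by positivity), inv_mul_cancel₀ (by positivity),
            ENNReal.ofReal_one, one_mul]
      -- For `p ≥ 1` the power `1 / p` is subadditive.
      _ ≤ _ := ENNReal.rpow_add_le_add_rpow _ _ hp1 (by rw [div_le_one hp0]; exact hp)
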